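/- Let $(M,g)$ be a compact smooth Riemannian manifold (without boundary) of dimension $n\ge 3$. For a one-form $\theta$ with dual vector field $\xi=\theta^\sharp$ put $\delta^*\theta=\tfrac12 L_\xi g$; let $\delta$ denote the divergence, $(\delta\varphi)_j=-\nabla^i\varphi_{ij}$ on symmetric two-tensors and $\delta\theta=-\nabla^i\theta_i$ on one-forms; and let $\Delta_S=2\delta\delta^*-d\delta$ be the Sampson Laplacian on one-forms. Suppose that the Ricci tensor of $(M,g)$ has a York decomposition $$\mathrm{Ric}=(\delta^*\theta+\lambda g)+\varphi^{TT},$$ where $\theta$ is a smooth one-form, $\lambda\in C^\infty(M)$, and $\varphi^{TT}$ is a smooth symmetric two-tensor with $\delta\varphi^{TT}=0$ and $\operatorname{trace}_g\varphi^{TT}=0$. Then $$\Delta_S\theta=-(n-2)\,d\lambda .$$ Consequently, if $M$ is connected, $\lambda$ is constant if and only if $\xi=\theta^\sharp$ is an infinitesimal harmonic transformation, i.e. the local transformations $\Phi_t$ generated by $\xi$ ($\Phi_0=\mathrm{id}$, $\partial_t\Phi_t|_{t=0}=\xi$) are harmonic to first order in $t$: their tension fields satisfy $\frac{d}{dt}\big|_{t=0}\tau(\Phi_t)=0$.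 -/

import Mathlib

open Bundle Filter Topology
open scoped Manifold ContDiff

noncomputable section

namespace YorkRicci

/-! ## Tensor calculus in a coordinate domain

A tensor field on a coordinate domain of `ℝⁿ` is given by its component functions.  Throughout, `G`
denotes the components `g_{ij}` of a Riemannian metric. -/

/-- The model space `ℝⁿ`. -/
abbrev Coord (n : ℕ) : Type := EuclideanSpace ℝ (Fin n)

section Local

variable {n : ℕ}

/-- The `i`-th partial derivative `∂_i f`. -/
def pd (i : Fin n) (f : Coord n → ℝ) (y : Coord n) : ℝ :=
  fderiv ℝ f y (EuclideanSpace.single i 1)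

/-- The components `g^{ij}` of the inverse metric. -/
def ginv (G : Fin n → Fin n → Coord n → ℝ) (i j : Fin n) (y : Coord n) : ℝ :=
  (Matrix.of fun a b => G a b y)⁻¹ i j

/-- The Christoffel symbols `Γ^k_{ij} = ½ g^{kl} (∂_i g_{jl} + ∂_j g_{il} - ∂_l g_{ij})` of the
Levi-Civita connection. -/
def christoffel (G : Fin n → Fin n → Coord n → ℝ) (k i j : Fin n) (y : Coord n) : ℝ :=
  (1 / 2) * ∑ l, ginv G k l y * (pd i (G j l) y + pd j (G i l) y - pd l (G i j) y)

/-- The Ricci tensor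
`R_{ij} = ∂_k Γ^k_{ij} - ∂_j Γ^k_{ik} + Γ^k_{kl} Γ^l_{ij} - Γ^k_{jl} Γ^l_{ik}`
(positive on round spheres). -/
def ricci (G : Fin n → Fin n → Coord n → ℝ) (i j : Fin n) (y : Coord n) : ℝ :=
  ∑ k, (pd k (christoffel G k i j) y - pd j (christoffel G k i k) y
    + ∑ l, (christoffel G k k l y * christoffel G l i j y
        - christoffel G k j l y * christoffel G l i k y))

/-- The trace `g^{ij} φ_{ij}`. -/
def trace (G φ : Fin n → Fin n → Coord n → ℝ) (y : Coord n) : ℝ :=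
  ∑ i, ∑ j, ginv G i j y * φ i j y

/-- The codifferential `δθ = -g^{ij} ∇_i θ_j` of a one-form. -/
def codiff (G : Fin n → Fin n → Coord n → ℝ) (θ : Fin n → Coord n → ℝ) (y : Coord n) : ℝ :=
  -∑ i, ∑ j, ginv G i j y * (pd i (θ j) y - ∑ k, christoffel G k i j y * θ k y)

/-- The divergence `(δφ)_j = -g^{ik} ∇_i φ_{kj}` of a symmetric two-tensor, the formal adjoint of
`δ^*`. -/
def divergence (G φ : Fin n → Fin n → Coord n → ℝ) (j : Fin n) (y : Coord n) : ℝ :=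
  -∑ i, ∑ k, ginv G i k y * (pd i (φ k j) y
      - ∑ l, christoffel G l i k y * φ l j y - ∑ l, christoffel G l i j y * φ k l y)

/-- The components `θ^i = g^{ij} θ_j` of the vector field `θ^♯`. -/
def sharp (G : Fin n → Fin n → Coord n → ℝ) (θ : Fin n → Coord n → ℝ) (i : Fin n)
    (y : Coord n) : ℝ :=
  ∑ j, ginv G i j y * θ j y

/-- The Lie derivative of the metric,
`(L_ξ g)_{ij} = ξ^l ∂_l g_{ij} + g_{lj} ∂_i ξ^l + g_{il} ∂_j ξ^l`. -/
def lieMetric (G : Fin n → Fin n → Coord n → ℝ) (ξ : Fin n → Coord n → ℝ) (i j : Fin n)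
    (y : Coord n) : ℝ :=
  ∑ l, (ξ l y * pd l (G i j) y + G l j y * pd i (ξ l) y + G i l y * pd j (ξ l) y)

/-- The operator `δ^* θ = ½ L_{θ^♯} g`. -/
def deltaStar (G : Fin n → Fin n → Coord n → ℝ) (θ : Fin n → Coord n → ℝ) (i j : Fin n)
    (y : Coord n) : ℝ :=
  (1 / 2) * lieMetric G (sharp G θ) i j y

/-- The Sampson Laplacian `Δ_S = 2 δ δ^* - d δ` on one-forms. -/
def sampson (G : Fin n → Fin n → Coord n → ℝ) (θ : Fin n → Coord n → ℝ) (i : Fin n)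
    (y : Coord n) : ℝ :=
  2 * divergence G (deltaStar G θ) i y - pd i (codiff G θ) y

/-- The tension field of a map `f` from the coordinate domain to itself (both sides with the metric
`G`): `τ(f)^k = g^{ij} (∂_i ∂_j f^k - Γ^l_{ij} ∂_l f^k + Γ^k_{ab}(f) ∂_i f^a ∂_j f^b)`.  The map `f`
is harmonic if and only if `τ(f) = 0`. -/
def tension (G : Fin n → Fin n → Coord n → ℝ) (f : Coord n → Coord n) (k : Fin n)
    (y : Coord n) : ℝ :=
  ∑ i, ∑ j, ginv G i j y *
    (pd i (pd j fun z => f z k) y - ∑ l, christoffel G l i j y * pd l (fun z => f z k) y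
      + ∑ a, ∑ b, christoffel G k a b (f y) * pd i (fun z => f z a) y * pd j (fun z => f z b) y)

/-- `Φ` is, near `(0, y)`, a smooth one-parameter family of local transformations with `Φ_0 = id`
which is generated by the vector field `ξ`, i.e. with velocity `ξ` at time `0`.  The local
one-parameter group (flow) of `ξ` is such a family, and any other one agrees with it to first order
in `t`. -/
def IsLocalFamily (ξ : Fin n → Coord n → ℝ) (Φ : ℝ → Coord n → Coord n) (y : Coord n) : Prop :=
  ContDiffAt ℝ ∞ (fun p : ℝ × Coord n => Φ p.1 p.2) (0, y) ∧
  ∀ᶠ z in 𝓝 y, Φ 0 z = z ∧ ∀ k, HasDerivAt (fun t => Φ t z k) (ξ k z) 0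

end Local

/-! ## Tensor fields on a manifold -/

section Global

variable {n : ℕ} {M : Type*} [TopologicalSpace M] [ChartedSpace (Coord n) M]

/-- The coordinate vector field `∂_i` of the chart `e`, at the point with coordinates `y`. -/
def frame (e : OpenPartialHomeomorph M (Coord n)) (i : Fin n) (y : Coord n) :
    TangentSpace (𝓡 n) (e.symm y) :=
  mfderiv (𝓡 n) (𝓡 n) e.symm y (EuclideanSpace.single i (1 : ℝ) : Coord n)

/-- The components `ξ^i = dx^i(ξ)` of a vector field in the chart `e`. -/
def vecComp (e : OpenPartialHomeomorph M (Coord n)) (ξ : Π x : M, TangentSpace (𝓡 n) x)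
    (i : Fin n) (y : Coord n) : ℝ :=
  EuclideanSpace.proj (𝕜 := ℝ) i (mfderiv (𝓡 n) (𝓡 n) e (e.symm y) (ξ (e.symm y)))

/-- The components `θ_i = θ(∂_i)` of a one-form in the chart `e`. -/
def formComp (e : OpenPartialHomeomorph M (Coord n))
    (θ : Π x : M, TangentSpace (𝓡 n) x →L[ℝ] ℝ) (i : Fin n) (y : Coord n) : ℝ :=
  θ (e.symm y) (frame e i y)

/-- The components `φ_{ij} = φ(∂_i, ∂_j)` of a covariant two-tensor in the chart `e`. -/
def tensorComp (e : OpenPartialHomeomorph M (Coord n))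
    (φ : Π x : M, TangentSpace (𝓡 n) x →L[ℝ] TangentSpace (𝓡 n) x →L[ℝ] ℝ)
    (i j : Fin n) (y : Coord n) : ℝ :=
  φ (e.symm y) (frame e i y) (frame e j y)

variable (n M) in
/-- The smooth charts of the manifold. -/
abbrev charts [IsManifold (𝓡 n) ∞ M] : Set (OpenPartialHomeomorph M (Coord n)) :=
  IsManifold.maximalAtlas (𝓡 n) ∞ M

variable [IsManifold (𝓡 n) ∞ M]

variable (n M) in
/-- Smooth Riemannian metrics on `M`. -/
abbrev Metric : Type _ :=
  ContMDiffRiemannianMetric (𝓡 n) ∞ (Coord n) (fun x : M => TangentSpace (𝓡 n) x)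

variable (n M) in
/-- `C^∞(TM)`. -/
abbrev VectorField : Type _ :=
  ContMDiffSection (𝓡 n) (Coord n) ∞ (fun x : M => TangentSpace (𝓡 n) x)

variable (n M) in
/-- `C^∞(T^*M)`. -/
abbrev OneForm : Type _ :=
  ContMDiffSection (𝓡 n) (Coord n →L[ℝ] ℝ) ∞ (fun x : M => TangentSpace (𝓡 n) x →L[ℝ] ℝ)

variable (n M) in
/-- Smooth covariant two-tensors. -/
abbrev TwoTensor : Type _ :=
  ContMDiffSection (𝓡 n) (Coord n →L[ℝ] Coord n →L[ℝ] ℝ) ∞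
    (fun x : M => TangentSpace (𝓡 n) x →L[ℝ] TangentSpace (𝓡 n) x →L[ℝ] ℝ)

/-- `φ` is a TT-tensor: symmetric, divergence free and traceless. -/
structure IsTT (g : Metric n M) (φ : TwoTensor n M) : Prop where
  symm : ∀ (x : M) (v w : TangentSpace (𝓡 n) x), φ x v w = φ x w v
  divergence_eq_zero : ∀ e ∈ charts n M, ∀ y ∈ e.target, ∀ j,
    divergence (tensorComp e g.inner) (tensorComp e φ) j y = 0
  trace_eq_zero : ∀ e ∈ charts n M, ∀ y ∈ e.target,
    trace (tensorComp e g.inner) (tensorComp e φ) y = 0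

/-- `Ric = (δ^* θ + lam g) + φ` with a TT-tensor `φ`: a York decomposition of the Ricci tensor.
The identity of tensors is expressed by their components in every smooth chart. -/
structure IsYorkDecompositionRic (g : Metric n M) (θ : OneForm n M) (lam : C^∞⟮𝓡 n, M; ℝ⟯)
    (φ : TwoTensor n M) : Prop where
  isTT : IsTT g φ
  ricci_eq : ∀ e ∈ charts n M, ∀ y ∈ e.target, ∀ i j,
    ricci (tensorComp e g.inner) i j y =
      (deltaStar (tensorComp e g.inner) (formComp e θ) i j y
        + lam (e.symm y) * tensorComp e g.inner i j y) + tensorComp e φ i j y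

/-- `ξ` is an infinitesimal harmonic transformation: the transformations generated by `ξ` are
harmonic to first order, `d/dt τ(Φ_t) = 0` at `t = 0`. -/
def IsInfinitesimalHarmonic (g : Metric n M) (ξ : VectorField n M) : Prop :=
  ∀ e ∈ charts n M, ∀ y ∈ e.target, ∀ Φ : ℝ → Coord n → Coord n,
    IsLocalFamily (vecComp e ξ) Φ y →
      ∀ k, HasDerivAt (fun t => tension (tensorComp e g.inner) (Φ t) k y) 0 0

end Global

end YorkRicci

end

/-!
Taking the divergence of `Ric = δ^*θ + λ g + φ` and comparing with the contracted Bianchi identity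
`2 δ Ric = -ds`, where `s = -δθ + n λ` is the trace of the decomposition, gives
`2 δ δ^*θ = dδθ - (n - 2) dλ`.

The Lie derivative `(L_ξ Γ)^k_{ij}` of the Levi-Civita connection along `ξ` is symmetric in `i, j`
and equals `∇_i ∇_j ξ^k` plus a curvature term.  As an endomorphism in `k, j`, the curvature term is
skew-adjoint, so `∇_i h`, where `h = L_ξ g`, is `L_ξ Γ_i` plus its adjoint.  Tracing this over the
two pairs of indices shows that the metric trace of `L_ξ Γ`, lowered, is `-δh + dδθ = -Δ_S θ` for
`ξ = θ^♯`.  The same trace is the derivative of the tension field `τ(Φ_t)` at `t = 0`, so `ξ` is an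
infinitesimal harmonic transformation if and only if `Δ_S θ = 0`, that is, if and only if `dλ = 0`.
-/

noncomputable section

namespace YorkRicci

/-! ## Partial derivatives -/

section PartialDerivatives

variable {n : ℕ} {E F : Type*} [NormedAddCommGroup E] [NormedSpace ℝ E] [NormedAddCommGroup F]
  [NormedSpace ℝ F] {U : Set (Coord n)} {f f' : Coord n → E} {y : Coord n}

/-- The `i`-th partial derivative of a vector-valued function.  It extends `pd`, to which it is
definitionally equal on real-valued functions, to matrix-valued functions. -/
def pderiv (i : Fin n) (f : Coord n → E) (y : Coord n) : E :=
  fderiv ℝ f y (EuclideanSpace.single i 1)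

theorem pd_eq_pderiv (i : Fin n) (f : Coord n → ℝ) : pd i f = pderiv i f :=
  rfl

theorem pderiv_congr (h : f =ᶠ[𝓝 y] f') (i : Fin n) : pderiv i f y = pderiv i f' y := by
  simp only [pderiv, h.fderiv_eq]

theorem pderiv_const (c : E) (i : Fin n) : pderiv i (fun _ => c) y = 0 := by
  simp [pderiv]

theorem pderiv_add (hf : DifferentiableAt ℝ f y) (hf' : DifferentiableAt ℝ f' y) (i : Fin n) :
    pderiv i (fun z => f z + f' z) y = pderiv i f y + pderiv i f' y := by
  simp [pderiv, fderiv_fun_add hf hf']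

theorem pderiv_sub (hf : DifferentiableAt ℝ f y) (hf' : DifferentiableAt ℝ f' y) (i : Fin n) :
    pderiv i (fun z => f z - f' z) y = pderiv i f y - pderiv i f' y := by
  simp [pderiv, fderiv_fun_sub hf hf']

theorem pderiv_sum {ι : Type*} {s : Finset ι} {f : ι → Coord n → E}
    (hf : ∀ a ∈ s, DifferentiableAt ℝ (f a) y) (i : Fin n) :
    pderiv i (fun z => ∑ a ∈ s, f a z) y = ∑ a ∈ s, pderiv i (f a) y := by
  simp [pderiv, fderiv_fun_sum hf]

theorem pderiv_smul {c : Coord n → ℝ} (hc : DifferentiableAt ℝ c y) (hf : DifferentiableAt ℝ f y)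
    (i : Fin n) : pderiv i (fun z => c z • f z) y = c y • pderiv i f y + pderiv i c y • f y := by
  simp [pderiv, fderiv_fun_smul hc hf]

theorem pderiv_mul {A : Type*} [NormedRing A] [NormedAlgebra ℝ A] {X Y : Coord n → A}
    (hX : DifferentiableAt ℝ X y) (hY : DifferentiableAt ℝ Y y) (i : Fin n) :
    pderiv i (fun z => X z * Y z) y = pderiv i X y * Y y + X y * pderiv i Y y := by
  simp [pderiv, fderiv_fun_mul' hX hY, add_comm]

theorem pderiv_clm_comp (L : E →L[ℝ] F) (hf : DifferentiableAt ℝ f y) (i : Fin n) :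
    pderiv i (fun z => L (f z)) y = L (pderiv i f y) := by
  have h : HasFDerivAt (fun z => L (f z)) (L.comp (fderiv ℝ f y)) y :=
    L.hasFDerivAt.comp y hf.hasFDerivAt
  simp [pderiv, h.fderiv]

theorem pderiv_comm (hf : ContDiffAt ℝ 2 f y) (i j : Fin n) :
    pderiv i (pderiv j f) y = pderiv j (pderiv i f) y := by
  have hd : DifferentiableAt ℝ (fderiv ℝ f) y :=
    (hf.fderiv_right (m := 1) (by norm_num)).differentiableAt (by simp)
  have second (a b : Fin n) : pderiv a (pderiv b f) y =
      fderiv ℝ (fderiv ℝ f) y (EuclideanSpace.single a 1) (EuclideanSpace.single b 1) := by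
    change fderiv ℝ (fun z => fderiv ℝ f z (EuclideanSpace.single b 1)) y _ = _
    simp [fderiv_clm_apply hd (differentiableAt_const _)]
  rw [second, second, (hf.isSymmSndFDerivAt (by simp)).eq]

theorem differentiableAt_pderiv (hf : ContDiffAt ℝ 2 f y) (i : Fin n) :
    DifferentiableAt ℝ (pderiv i f) y :=
  ((hf.fderiv_right (m := 1) (by norm_num)).differentiableAt (by simp)).clm_apply
    (differentiableAt_const _)

theorem contDiffOn_pderiv (hU : IsOpen U) (hf : ContDiffOn ℝ ∞ f U) (i : Fin n) :
    ContDiffOn ℝ ∞ (pderiv i f) U :=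
  (hf.fderiv_of_isOpen hU (by simp)).clm_apply contDiffOn_const

theorem differentiableAt_of_contDiffOn (hU : IsOpen U) (hf : ContDiffOn ℝ ∞ f U) (hy : y ∈ U) :
    DifferentiableAt ℝ f y :=
  (hf.contDiffAt (hU.mem_nhds hy)).differentiableAt (by simp)

end PartialDerivatives

/-! ## Matrix-valued functions -/

section MatrixFunctions

open scoped Matrix Matrix.Norms.Operator

variable {n : ℕ} {E : Type*} [NormedAddCommGroup E] [NormedSpace ℝ E] {U : Set E}
  {X : E → Matrix (Fin n) (Fin n) ℝ}

/-- The continuous linear functional `X ↦ X i j` on matrices, through which the calculus of matrices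
is transported to their entries. -/
def entryCLM (i j : Fin n) : Matrix (Fin n) (Fin n) ℝ →L[ℝ] ℝ :=
  (Matrix.entryLinearMap ℝ ℝ i j).toContinuousLinearMap

/-- Transposition of matrices as a continuous linear map, for differentiating transposes. -/
def transposeCLM (n : ℕ) : Matrix (Fin n) (Fin n) ℝ →L[ℝ] Matrix (Fin n) (Fin n) ℝ :=
  (Matrix.transposeLinearEquiv (Fin n) (Fin n) ℝ ℝ).toLinearMap.toContinuousLinearMap

theorem contDiffOn_matrix {N : WithTop ℕ∞} :
    ContDiffOn ℝ N X U ↔ ∀ i j, ContDiffOn ℝ N (fun z => X z i j) U := by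
  refine ⟨fun h i j => (entryCLM i j).contDiff.comp_contDiffOn h, fun h => ?_⟩
  have hpi : ContDiffOn ℝ N (fun z i j => X z i j) U :=
    contDiffOn_pi.2 fun i => contDiffOn_pi.2 (h i)
  exact (Matrix.ofLinearEquiv ℝ).toLinearMap.toContinuousLinearMap.contDiff.comp_contDiffOn hpi

theorem contDiffOn_matrix_inv {N : WithTop ℕ∞} (hX : ContDiffOn ℝ N X U)
    (hdet : ∀ z ∈ U, IsUnit (X z).det) : ContDiffOn ℝ N (fun z => (X z)⁻¹) U := by
  intro z hz
  simp only [Matrix.nonsing_inv_eq_ringInverse]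
  exact (contDiffAt_ringInverse ℝ ((X z).isUnit_iff_isUnit_det.2 (hdet z hz)).unit)
    |>.comp_contDiffWithinAt z (hX z hz)

variable {y : Coord n} {Y : Coord n → Matrix (Fin n) (Fin n) ℝ}

theorem pderiv_apply (hY : DifferentiableAt ℝ Y y) (m i j : Fin n) :
    pderiv m Y y i j = pd m (fun z => Y z i j) y :=
  (pderiv_clm_comp (entryCLM i j) hY m).symm

theorem differentiableAt_transpose (hY : DifferentiableAt ℝ Y y) :
    DifferentiableAt ℝ (fun z => (Y z)ᵀ) y :=
  (transposeCLM n).differentiableAt.comp y hY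

theorem pderiv_transpose (hY : DifferentiableAt ℝ Y y) (m : Fin n) :
    pderiv m (fun z => (Y z)ᵀ) y = (pderiv m Y y)ᵀ :=
  pderiv_clm_comp (transposeCLM n) hY m

theorem pderiv_trace (hY : DifferentiableAt ℝ Y y) (m : Fin n) :
    pd m (fun z => (Y z).trace) y = (pderiv m Y y).trace :=
  pderiv_clm_comp (Matrix.traceLinearMap (Fin n) ℝ ℝ).toContinuousLinearMap hY m

end MatrixFunctions

/-! ## Connections -/

section Connection

variable {n : ℕ} {R : Type*} [NormedRing R] [NormedAlgebra ℝ R] {A : Fin n → Coord n → R}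
  {V W : Coord n → R} {y : Coord n}

/-- The curvature `F_{ij} = ∂_i A_j - ∂_j A_i + [A_i, A_j]` of the connection form `A`. -/
def curvature (A : Fin n → Coord n → R) (i j : Fin n) (y : Coord n) : R :=
  pderiv i (A j) y - pderiv j (A i) y + A i y * A j y - A j y * A i y

/-- The covariant derivative `∇_i V = ∂_i V + [A_i, V]` of a field of endomorphisms.  When `V` has
further indices, as in `V = F_{jk}`, they are not corrected by Christoffel symbols. -/
def covDeriv (A : Fin n → Coord n → R) (i : Fin n) (V : Coord n → R) (y : Coord n) : R :=
  pderiv i V y + A i y * V y - V y * A i y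

theorem curvature_swap (A : Fin n → Coord n → R) (i j : Fin n) (y : Coord n) :
    curvature A j i y = -curvature A i j y := by
  simp only [curvature]
  abel

theorem covDeriv_congr (h : V =ᶠ[𝓝 y] W) (i : Fin n) : covDeriv A i V y = covDeriv A i W y := by
  simp only [covDeriv, pderiv_congr h, h.eq_of_nhds]

theorem covDeriv_add (hV : DifferentiableAt ℝ V y) (hW : DifferentiableAt ℝ W y) (i : Fin n) :
    covDeriv A i (fun z => V z + W z) y = covDeriv A i V y + covDeriv A i W y := by
  simp only [covDeriv, pderiv_add hV hW]
  noncomm_ring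

theorem covDeriv_neg (i : Fin n) : covDeriv A i (fun z => -V z) y = -covDeriv A i V y := by
  simp only [covDeriv, pderiv, fderiv_fun_neg, neg_apply]
  noncomm_ring

theorem covDeriv_smul_one {c : Coord n → ℝ} (hc : DifferentiableAt ℝ c y) (i : Fin n) :
    covDeriv A i (fun z => c z • (1 : R)) y = pd i c y • 1 := by
  simp [covDeriv, pderiv_smul hc (differentiableAt_const _), pderiv_const, pd_eq_pderiv]

theorem pderiv_curvature (hA : ∀ i, ContDiffAt ℝ 2 (A i) y) (m i j : Fin n) :
    pderiv m (curvature A i j) y = pderiv m (pderiv i (A j)) y - pderiv m (pderiv j (A i)) y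
      + (pderiv m (A i) y * A j y + A i y * pderiv m (A j) y)
      - (pderiv m (A j) y * A i y + A j y * pderiv m (A i) y) := by
  have hA₁ (i) : DifferentiableAt ℝ (A i) y := (hA i).differentiableAt (by simp)
  have hA₂ (i j) : DifferentiableAt ℝ (pderiv i (A j)) y := differentiableAt_pderiv (hA j) i
  have hmul (i j) := (hA₁ i).fun_mul (hA₁ j)
  rw [← pderiv_mul (hA₁ i) (hA₁ j), ← pderiv_mul (hA₁ j) (hA₁ i), ← pderiv_sub (hA₂ i j) (hA₂ j i),
    ← pderiv_add ((hA₂ i j).fun_sub (hA₂ j i)) (hmul i j),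
    ← pderiv_sub (((hA₂ i j).fun_sub (hA₂ j i)).fun_add (hmul i j)) (hmul j i)]
  rfl

theorem covDeriv_curvature_cyclic (hA : ∀ i, ContDiffAt ℝ 2 (A i) y) (m i j : Fin n) :
    covDeriv A m (curvature A i j) y + covDeriv A i (curvature A j m) y
      + covDeriv A j (curvature A m i) y = 0 := by
  simp only [covDeriv, pderiv_curvature hA]
  rw [pderiv_comm (hA j) m i, pderiv_comm (hA i) m j, pderiv_comm (hA m) i j]
  simp only [curvature]
  noncomm_ring

end Connection

/-! ## The Levi-Civita connection in coordinates -/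

section LeviCivita

open scoped Matrix Matrix.Norms.Operator

variable {n : ℕ} {U : Set (Coord n)} {G : Fin n → Fin n → Coord n → ℝ} {y : Coord n}

/-- `G` gives the components of a smooth nondegenerate symmetric two-tensor on the open set `U`:
a semi-Riemannian metric in coordinates. -/
structure IsMetricOn (U : Set (Coord n)) (G : Fin n → Fin n → Coord n → ℝ) : Prop where
  isOpen : IsOpen U
  smooth : ∀ i j, ContDiffOn ℝ ∞ (G i j) U
  symm : ∀ z ∈ U, ∀ i j, G i j z = G j i z
  isUnit_det : ∀ z ∈ U, IsUnit (Matrix.of fun a b => G a b z).det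

/-- The matrix of components of a two-tensor. -/
def compMat (φ : Fin n → Fin n → Coord n → ℝ) (y : Coord n) : Matrix (Fin n) (Fin n) ℝ :=
  Matrix.of fun i j => φ i j y

/-- The matrix `g^{ij}`. -/
def invMat (G : Fin n → Fin n → Coord n → ℝ) (y : Coord n) : Matrix (Fin n) (Fin n) ℝ :=
  (compMat G y)⁻¹

/-- The connection form `(A_i)^l_k = Γ^l_{ik}`. -/
def connMat (G : Fin n → Fin n → Coord n → ℝ) (i : Fin n) (y : Coord n) :
    Matrix (Fin n) (Fin n) ℝ :=
  Matrix.of fun l k => christoffel G l i k y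

/-- The adjoint `g⁻¹ Vᵀ g` of a field of endomorphisms with respect to the metric. -/
def metricAdjoint (G : Fin n → Fin n → Coord n → ℝ) (V : Coord n → Matrix (Fin n) (Fin n) ℝ)
    (y : Coord n) : Matrix (Fin n) (Fin n) ℝ :=
  invMat G y * (V y)ᵀ * compMat G y

theorem contDiffOn_compMat {φ : Fin n → Fin n → Coord n → ℝ}
    (hφ : ∀ i j, ContDiffOn ℝ ∞ (φ i j) U) : ContDiffOn ℝ ∞ (compMat φ) U :=
  contDiffOn_matrix.2 hφ

namespace IsMetricOn

theorem compMat_transpose (hG : IsMetricOn U G) (hy : y ∈ U) : (compMat G y)ᵀ = compMat G y := by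
  ext a b
  exact hG.symm y hy b a

theorem compMat_mul_invMat (hG : IsMetricOn U G) (hy : y ∈ U) : compMat G y * invMat G y = 1 :=
  Matrix.mul_nonsing_inv _ (hG.isUnit_det y hy)

theorem invMat_mul_compMat (hG : IsMetricOn U G) (hy : y ∈ U) : invMat G y * compMat G y = 1 :=
  Matrix.nonsing_inv_mul _ (hG.isUnit_det y hy)

theorem invMat_transpose (hG : IsMetricOn U G) (hy : y ∈ U) : (invMat G y)ᵀ = invMat G y := by
  rw [invMat, Matrix.transpose_nonsing_inv, hG.compMat_transpose hy]

theorem eventually_mem (hG : IsMetricOn U G) (hy : y ∈ U) : ∀ᶠ z in 𝓝 y, z ∈ U :=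
  hG.isOpen.mem_nhds hy

theorem contDiffOn_invMat (hG : IsMetricOn U G) : ContDiffOn ℝ ∞ (invMat G) U :=
  contDiffOn_matrix_inv (contDiffOn_compMat hG.smooth) hG.isUnit_det

theorem contDiffOn_christoffel (hG : IsMetricOn U G) (k i j : Fin n) :
    ContDiffOn ℝ ∞ (christoffel G k i j) U := by
  have hinv (l) : ContDiffOn ℝ ∞ (ginv G k l) U := contDiffOn_matrix.1 hG.contDiffOn_invMat k l
  have hpd (m a b) : ContDiffOn ℝ ∞ (pd m (G a b)) U :=
    contDiffOn_pderiv hG.isOpen (hG.smooth a b) m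
  exact contDiffOn_const.mul (ContDiffOn.sum fun l _ =>
    (hinv l).mul (((hpd i j l).add (hpd j i l)).sub (hpd l i j)))

theorem contDiffOn_connMat (hG : IsMetricOn U G) (i : Fin n) : ContDiffOn ℝ ∞ (connMat G i) U :=
  contDiffOn_matrix.2 fun l k => hG.contDiffOn_christoffel l i k

theorem contDiffAt_connMat (hG : IsMetricOn U G) (hy : y ∈ U) (i : Fin n) :
    ContDiffAt ℝ 2 (connMat G i) y :=
  ((hG.contDiffOn_connMat i).contDiffAt (hG.isOpen.mem_nhds hy)).of_le (by norm_cast)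

theorem differentiableAt (hG : IsMetricOn U G) (hy : y ∈ U) {E : Type*} [NormedAddCommGroup E]
    [NormedSpace ℝ E] {f : Coord n → E} (hf : ContDiffOn ℝ ∞ f U) : DifferentiableAt ℝ f y :=
  differentiableAt_of_contDiffOn hG.isOpen hf hy

theorem contDiffOn_curvature (hG : IsMetricOn U G) (i j : Fin n) :
    ContDiffOn ℝ ∞ (curvature (connMat G) i j) U := by
  have hA := hG.contDiffOn_connMat
  have hdA (i j) := contDiffOn_pderiv hG.isOpen (hA j) i
  exact (((hdA i j).sub (hdA j i)).add ((hA i).mul (hA j))).sub ((hA j).mul (hA i))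

theorem pd_symm (hG : IsMetricOn U G) (hy : y ∈ U) (l i j : Fin n) :
    pd l (G i j) y = pd l (G j i) y :=
  pderiv_congr ((hG.eventually_mem hy).mono fun z hz => hG.symm z hz i j) l

theorem christoffel_symm (hG : IsMetricOn U G) (hy : y ∈ U) (k i j : Fin n) :
    christoffel G k i j y = christoffel G k j i y := by
  simp only [christoffel, hG.pd_symm hy _ i j, add_comm (pd i (G j _) y)]

theorem sum_mul_christoffel (hG : IsMetricOn U G) (hy : y ∈ U) (a i b : Fin n) :
    ∑ l, G a l y * christoffel G l i b y =
      1 / 2 * (pd i (G b a) y + pd b (G i a) y - pd a (G i b) y) := by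
  set v : Fin n → ℝ := fun m => 1 / 2 * (pd i (G b m) y + pd b (G i m) y - pd m (G i b) y) with hv
  have christoffel_eq : (fun l => christoffel G l i b y) = invMat G y *ᵥ v := by
    funext l
    simp only [christoffel, Matrix.mulVec, dotProduct, hv, Finset.mul_sum]
    exact Finset.sum_congr rfl fun m _ => mul_left_comm _ _ _
  have lowered : compMat G y *ᵥ (fun l => christoffel G l i b y) = v := by
    rw [christoffel_eq, Matrix.mulVec_mulVec, hG.compMat_mul_invMat hy, Matrix.one_mulVec]
  exact congrFun lowered a

theorem pderiv_compMat (hG : IsMetricOn U G) (hy : y ∈ U) (i : Fin n) :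
    pderiv i (compMat G) y =
      compMat G y * connMat G i y + (connMat G i y)ᵀ * compMat G y := by
  ext a b
  have second : ∑ l, christoffel G l i a y * G l b y =
      1 / 2 * (pd i (G a b) y + pd a (G i b) y - pd b (G i a) y) := by
    rw [← hG.sum_mul_christoffel hy b i a]
    exact Finset.sum_congr rfl fun l _ => by rw [hG.symm y hy l b, mul_comm]
  rw [pderiv_apply (hG.differentiableAt hy (contDiffOn_compMat hG.smooth))]
  change pd i (G a b) y = ∑ l, G a l y * christoffel G l i b y
    + ∑ l, christoffel G l i a y * G l b y
  rw [hG.sum_mul_christoffel hy a i b, second, hG.pd_symm hy i b a]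
  ring

theorem pderiv_invMat (hG : IsMetricOn U G) (hy : y ∈ U) (i : Fin n) :
    pderiv i (invMat G) y =
      -(connMat G i y * invMat G y + invMat G y * (connMat G i y)ᵀ) := by
  have hconst : (fun z => compMat G z * invMat G z) =ᶠ[𝓝 y] fun _ => 1 :=
    (hG.eventually_mem hy).mono fun z hz => hG.compMat_mul_invMat hz
  have leibniz : pderiv i (compMat G) y * invMat G y + compMat G y * pderiv i (invMat G) y = 0 := by
    rw [← pderiv_mul (hG.differentiableAt hy (contDiffOn_compMat hG.smooth))
      (hG.differentiableAt hy hG.contDiffOn_invMat), pderiv_congr hconst, pderiv_const]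
  calc pderiv i (invMat G) y
      = invMat G y * (compMat G y * pderiv i (invMat G) y) := by
        rw [← mul_assoc, hG.invMat_mul_compMat hy, one_mul]
    _ = -(invMat G y * compMat G y * connMat G i y * invMat G y
          + invMat G y * (connMat G i y)ᵀ * (compMat G y * invMat G y)) := by
        rw [eq_neg_of_add_eq_zero_right leibniz, hG.pderiv_compMat hy]
        noncomm_ring
    _ = _ := by rw [hG.invMat_mul_compMat hy, hG.compMat_mul_invMat hy, one_mul, mul_one]

theorem covDeriv_metricAdjoint (hG : IsMetricOn U G) (hy : y ∈ U)
    {V : Coord n → Matrix (Fin n) (Fin n) ℝ} (hV : DifferentiableAt ℝ V y) (i : Fin n) :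
    covDeriv (connMat G) i (metricAdjoint G V) y =
      metricAdjoint G (covDeriv (connMat G) i V) y := by
  have hg := hG.differentiableAt hy (contDiffOn_compMat hG.smooth)
  have hginv := hG.differentiableAt hy hG.contDiffOn_invMat
  have hVt : DifferentiableAt ℝ (fun z => (V z)ᵀ) y := differentiableAt_transpose hV
  simp only [covDeriv, metricAdjoint]
  rw [show metricAdjoint G V = fun z => invMat G z * (V z)ᵀ * compMat G z from rfl,
    pderiv_mul (hginv.fun_mul hVt) hg, pderiv_mul hginv hVt, pderiv_transpose hV,
    hG.pderiv_compMat hy, hG.pderiv_invMat hy]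
  simp only [Matrix.transpose_add, Matrix.transpose_sub, Matrix.transpose_mul]
  noncomm_ring

/-- Commuting second derivatives of `g` make the Riemann tensor skew in its last two indices. -/
theorem compMat_mul_curvature (hG : IsMetricOn U G) (hy : y ∈ U) (i j : Fin n) :
    compMat G y * curvature (connMat G) i j y
      + (curvature (connMat G) i j y)ᵀ * compMat G y = 0 := by
  have hg := hG.differentiableAt hy (contDiffOn_compMat hG.smooth)
  have hA (i) := hG.differentiableAt hy (hG.contDiffOn_connMat i)
  have hAt (i) : DifferentiableAt ℝ (fun z => (connMat G i z)ᵀ) y :=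
    differentiableAt_transpose (hA i)
  have second (i j : Fin n) : pderiv i (pderiv j (compMat G)) y =
      pderiv i (compMat G) y * connMat G j y + compMat G y * pderiv i (connMat G j) y
        + ((pderiv i (connMat G j) y)ᵀ * compMat G y
          + (connMat G j y)ᵀ * pderiv i (compMat G) y) := by
    rw [pderiv_congr ((hG.eventually_mem hy).mono fun z hz => hG.pderiv_compMat hz j),
      pderiv_add (hg.fun_mul (hA j)) ((hAt j).fun_mul hg), pderiv_mul hg (hA j),
      pderiv_mul (hAt j) hg, pderiv_transpose (hA j)]
  have hcomm : pderiv i (pderiv j (compMat G)) y = pderiv j (pderiv i (compMat G)) y :=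
    pderiv_comm (((contDiffOn_compMat hG.smooth).contDiffAt (hG.eventually_mem hy)).of_le
      (by norm_cast)) i j
  rw [second, second, hG.pderiv_compMat hy, hG.pderiv_compMat hy] at hcomm
  simp only [curvature, Matrix.transpose_add, Matrix.transpose_sub, Matrix.transpose_mul]
  linear_combination (norm := noncomm_ring) hcomm

theorem metricAdjoint_curvature (hG : IsMetricOn U G) (hy : y ∈ U) (i j : Fin n) :
    metricAdjoint G (curvature (connMat G) i j) y = -curvature (connMat G) i j y := by
  rw [metricAdjoint, mul_assoc, eq_neg_of_add_eq_zero_right (hG.compMat_mul_curvature hy i j),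
    mul_neg, ← mul_assoc, hG.invMat_mul_compMat hy, one_mul]

theorem transpose_mul_invMat (hG : IsMetricOn U G) (hy : y ∈ U)
    (V : Coord n → Matrix (Fin n) (Fin n) ℝ) :
    (V y * invMat G y)ᵀ = metricAdjoint G V y * invMat G y := by
  rw [metricAdjoint, mul_assoc, hG.compMat_mul_invMat hy, mul_one, Matrix.transpose_mul,
    hG.invMat_transpose hy]

end IsMetricOn

end LeviCivita

/-! ## Divergence and trace of two-tensors -/

section TwoTensors

open scoped Matrix Matrix.Norms.Operator

variable {n : ℕ} {U : Set (Coord n)} {G φ ψ : Fin n → Fin n → Coord n → ℝ} {y : Coord n}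

/-- The two-tensor `φ` with its first index raised: the field of endomorphisms `g^{ik} φ_{kj}`. -/
def raise (G φ : Fin n → Fin n → Coord n → ℝ) (y : Coord n) : Matrix (Fin n) (Fin n) ℝ :=
  invMat G y * compMat φ y

theorem divergence_congr (h : ∀ i j, φ i j =ᶠ[𝓝 y] ψ i j) (j : Fin n) :
    divergence G φ j y = divergence G ψ j y := by
  simp only [divergence, pd_eq_pderiv, pderiv_congr (h _ _), (h _ _).eq_of_nhds]

theorem divergence_add (hφ : ∀ i j, DifferentiableAt ℝ (φ i j) y)
    (hψ : ∀ i j, DifferentiableAt ℝ (ψ i j) y) (j : Fin n) :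
    divergence G (fun i j z => φ i j z + ψ i j z) j y =
      divergence G φ j y + divergence G ψ j y := by
  simp only [divergence, pd_eq_pderiv, pderiv_add (hφ _ _) (hψ _ _), mul_add, mul_sub,
    Finset.sum_add_distrib, Finset.sum_sub_distrib]
  ring

theorem trace_add : trace G (fun i j z => φ i j z + ψ i j z) y = trace G φ y + trace G ψ y := by
  simp only [trace, mul_add, Finset.sum_add_distrib]

namespace IsMetricOn

theorem contDiffOn_raise (hG : IsMetricOn U G) (hφ : ∀ i j, ContDiffOn ℝ ∞ (φ i j) U) :
    ContDiffOn ℝ ∞ (raise G φ) U :=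
  hG.contDiffOn_invMat.mul (contDiffOn_compMat hφ)

theorem covDeriv_raise (hG : IsMetricOn U G) (hy : y ∈ U) (hφ : DifferentiableAt ℝ (compMat φ) y)
    (i : Fin n) : covDeriv (connMat G) i (raise G φ) y =
      invMat G y * (pderiv i (compMat φ) y - (connMat G i y)ᵀ * compMat φ y
        - compMat φ y * connMat G i y) := by
  simp only [covDeriv, raise]
  rw [show raise G φ = fun z => invMat G z * compMat φ z from rfl,
    pderiv_mul (hG.differentiableAt hy hG.contDiffOn_invMat) hφ, hG.pderiv_invMat hy]
  noncomm_ring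

theorem divergence_eq_neg_sum_covDeriv (hG : IsMetricOn U G) (hy : y ∈ U)
    (hφ : DifferentiableAt ℝ (compMat φ) y) (j : Fin n) :
    divergence G φ j y = -∑ i, covDeriv (connMat G) i (raise G φ) y i j := by
  simp only [divergence, hG.covDeriv_raise hy hφ]
  congr! 2 with i
  refine Finset.sum_congr rfl fun k _ => ?_
  simp only [Matrix.sub_apply, pderiv_apply hφ, Matrix.mul_apply, Matrix.transpose_apply,
    mul_comm (compMat φ y k _)]
  rfl

theorem trace_eq_trace_raise (hG : IsMetricOn U G) (hy : y ∈ U)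
    (φ : Fin n → Fin n → Coord n → ℝ) : trace G φ y = (raise G φ y).trace := by
  simp only [raise, trace, Matrix.trace, Matrix.diag_apply, Matrix.mul_apply]
  rw [Finset.sum_comm]
  refine Finset.sum_congr rfl fun i _ => Finset.sum_congr rfl fun k _ => ?_
  rw [← congrFun₂ (hG.invMat_transpose hy) i k]
  rfl

theorem raise_smul_metric (hG : IsMetricOn U G) (hy : y ∈ U) (c : Coord n → ℝ) :
    raise G (fun i j z => c z * G i j z) y = c y • 1 := by
  rw [← hG.invMat_mul_compMat hy, ← Matrix.mul_smul]
  rfl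

theorem trace_smul_metric (hG : IsMetricOn U G) (hy : y ∈ U) (c : Coord n → ℝ) :
    trace G (fun i j z => c z * G i j z) y = n * c y := by
  rw [hG.trace_eq_trace_raise hy, hG.raise_smul_metric hy]
  simp [mul_comm]

theorem divergence_smul_metric (hG : IsMetricOn U G) (hy : y ∈ U) {c : Coord n → ℝ}
    (hc : ContDiffOn ℝ ∞ c U) (j : Fin n) :
    divergence G (fun i j z => c z * G i j z) j y = -pd j c y := by
  rw [hG.divergence_eq_neg_sum_covDeriv hy (hG.differentiableAt hy
    (contDiffOn_compMat fun a b => hc.mul (hG.smooth a b)))]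
  simp only [covDeriv_congr ((hG.eventually_mem hy).mono fun _ hz => hG.raise_smul_metric hz c),
    covDeriv_smul_one (hG.differentiableAt hy hc)]
  simp [Matrix.one_apply]

theorem contDiffOn_codiff (hG : IsMetricOn U G) {θ : Fin n → Coord n → ℝ}
    (hθ : ∀ i, ContDiffOn ℝ ∞ (θ i) U) : ContDiffOn ℝ ∞ (codiff G θ) U := by
  have hinv := contDiffOn_matrix.1 hG.contDiffOn_invMat
  have hdθ (i j) : ContDiffOn ℝ ∞ (pd i (θ j)) U := contDiffOn_pderiv hG.isOpen (hθ j) i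
  exact (ContDiffOn.sum fun i _ => ContDiffOn.sum fun j _ => (hinv i j).mul
    ((hdθ i j).sub (ContDiffOn.sum fun k _ => (hG.contDiffOn_christoffel k i j).mul (hθ k)))).neg

end IsMetricOn

end TwoTensors

/-! ## The contracted Bianchi identity -/

section ContractedBianchi

open scoped Matrix Matrix.Norms.Operator

variable {n : ℕ} {U : Set (Coord n)} {G : Fin n → Fin n → Coord n → ℝ} {y : Coord n}

/-- The curvature tensor `R_{ij}{}^{ab}`, as a matrix in `a, b`: the curvature of the Levi-Civita
connection with its last index raised, which makes it an antisymmetric matrix. -/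
def curvUp (G : Fin n → Fin n → Coord n → ℝ) (i j : Fin n) (y : Coord n) :
    Matrix (Fin n) (Fin n) ℝ :=
  curvature (connMat G) i j y * invMat G y

/-- The covariant derivative `∇_m R_{ij}{}^{ab}`, as a matrix in `a, b`; the indices `i, j` are not
corrected by Christoffel symbols. -/
def covCurvUp (G : Fin n → Fin n → Coord n → ℝ) (m i j : Fin n) (y : Coord n) :
    Matrix (Fin n) (Fin n) ℝ :=
  covDeriv (connMat G) m (curvature (connMat G) i j) y * invMat G y

theorem sum_mul_eq_zero_of_symm_of_antisymm {S N : Fin n → Fin n → ℝ}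
    (hS : ∀ a b, S a b = S b a) (hN : ∀ a b, N a b = -N b a) : ∑ a, ∑ b, S a b * N a b = 0 := by
  have h : ∑ a, ∑ b, S a b * N a b = -∑ a, ∑ b, S a b * N a b := by
    conv_lhs => rw [Finset.sum_comm]
    simp only [← Finset.sum_neg_distrib]
    refine Finset.sum_congr rfl fun a _ => Finset.sum_congr rfl fun b _ => ?_
    rw [hS b a, hN b a, mul_neg]
  linarith

theorem covCurvUp_swap (G : Fin n → Fin n → Coord n → ℝ) (m i j : Fin n) (y : Coord n) :
    covCurvUp G m j i y = -covCurvUp G m i j y := by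
  simp only [covCurvUp]
  rw [show curvature (connMat G) j i = fun z => -curvature (connMat G) i j z from
    funext (curvature_swap _ i j), covDeriv_neg, neg_mul]

namespace IsMetricOn

theorem curvUp_antisymm (hG : IsMetricOn U G) (hy : y ∈ U) (i j a b : Fin n) :
    curvUp G i j y a b = -curvUp G i j y b a := by
  have skew : (curvUp G i j y)ᵀ = -curvUp G i j y := by
    rw [curvUp, hG.transpose_mul_invMat hy, hG.metricAdjoint_curvature hy, neg_mul]
  exact congrFun₂ skew b a

theorem covCurvUp_antisymm (hG : IsMetricOn U G) (hy : y ∈ U) (m i j a b : Fin n) :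
    covCurvUp G m i j y a b = -covCurvUp G m i j y b a := by
  have hF := hG.differentiableAt hy (hG.contDiffOn_curvature i j)
  have skew_near : metricAdjoint G (curvature (connMat G) i j) =ᶠ[𝓝 y]
      fun z => -curvature (connMat G) i j z :=
    (hG.eventually_mem hy).mono fun z hz => hG.metricAdjoint_curvature hz i j
  have skew : (covCurvUp G m i j y)ᵀ = -covCurvUp G m i j y := by
    rw [covCurvUp, hG.transpose_mul_invMat hy, ← hG.covDeriv_metricAdjoint hy hF,
      covDeriv_congr skew_near, covDeriv_neg, neg_mul]
  exact congrFun₂ skew b a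

theorem covCurvUp_eq (hG : IsMetricOn U G) (hy : y ∈ U) (m i j : Fin n) :
    covCurvUp G m i j y = pderiv m (curvUp G i j) y + connMat G m y * curvUp G i j y
      + curvUp G i j y * (connMat G m y)ᵀ := by
  have hF := hG.differentiableAt hy (hG.contDiffOn_curvature i j)
  rw [covCurvUp, covDeriv, curvUp,
    show curvUp G i j = fun z => curvature (connMat G) i j z * invMat G z from rfl,
    pderiv_mul hF (hG.differentiableAt hy hG.contDiffOn_invMat), hG.pderiv_invMat hy]
  noncomm_ring

theorem ricci_eq_sum_curvature (hG : IsMetricOn U G) (hy : y ∈ U) (k j : Fin n) :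
    ricci G k j y = ∑ i, curvature (connMat G) i j y i k := by
  have hA (i) := hG.differentiableAt hy (hG.contDiffOn_connMat i)
  have hpd (m l i j) : pd m (christoffel G l i j) y = pd m (christoffel G l j i) y :=
    pderiv_congr ((hG.eventually_mem hy).mono fun z hz => hG.christoffel_symm hz l i j) m
  refine Finset.sum_congr rfl fun i _ => ?_
  simp only [curvature, Matrix.sub_apply, Matrix.add_apply, pderiv_apply (hA _), Matrix.mul_apply,
    Finset.sum_sub_distrib, add_sub_assoc]
  rw [hpd i i k j, hpd j i k i]
  simp only [hG.christoffel_symm hy _ k _]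
  rfl

theorem contDiffOn_ricci (hG : IsMetricOn U G) (i j : Fin n) : ContDiffOn ℝ ∞ (ricci G i j) U :=
  (ContDiffOn.sum fun a _ => contDiffOn_matrix.1 (hG.contDiffOn_curvature a j) a i).congr
    fun _ hz => hG.ricci_eq_sum_curvature hz i j

theorem raise_ricci_apply (hG : IsMetricOn U G) (hy : y ∈ U) (k j : Fin n) :
    raise G (ricci G) y k j = ∑ i, curvUp G i j y i k := by
  simp only [raise, curvUp, Matrix.mul_apply]
  rw [Finset.sum_comm]
  refine Finset.sum_congr rfl fun l _ => ?_
  rw [← Finset.sum_mul, ← hG.ricci_eq_sum_curvature hy,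
    ← congrFun₂ (hG.invMat_transpose hy) k l, mul_comm]
  rfl

theorem contDiffOn_curvUp (hG : IsMetricOn U G) (i j : Fin n) : ContDiffOn ℝ ∞ (curvUp G i j) U :=
  (hG.contDiffOn_curvature i j).mul hG.contDiffOn_invMat

theorem pderiv_raise_ricci_apply (hG : IsMetricOn U G) (hy : y ∈ U) (m k j : Fin n) :
    pderiv m (raise G (ricci G)) y k j = ∑ i, pderiv m (curvUp G i j) y i k := by
  have hR (i) := hG.differentiableAt hy (hG.contDiffOn_curvUp i j)
  simp only [pderiv_apply (hR _), pd_eq_pderiv]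
  rw [pderiv_apply (hG.differentiableAt hy (hG.contDiffOn_raise hG.contDiffOn_ricci)), pd_eq_pderiv,
    pderiv_congr ((hG.eventually_mem hy).mono fun z hz => hG.raise_ricci_apply hz k j), pderiv_sum]
  exact fun i _ => hG.differentiableAt hy (contDiffOn_matrix.1 (hG.contDiffOn_curvUp i j) i k)

theorem sum_covCurvUp_divergence (hG : IsMetricOn U G) (hy : y ∈ U) (j : Fin n) :
    ∑ i, ∑ m, covCurvUp G m i j y i m = ∑ m, (pderiv m (raise G (ricci G)) y
      + connMat G m y * raise G (ricci G) y) m j := by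
  have hsymm (i) : ∑ m, (connMat G m y * curvUp G i j y) i m = 0 :=
    sum_mul_eq_zero_of_symm_of_antisymm (S := fun m l => christoffel G i m l y)
      (N := fun m l => curvUp G i j y l m) (hG.christoffel_symm hy i)
      (fun m l => hG.curvUp_antisymm hy i j l m)
  simp only [hG.covCurvUp_eq hy, Matrix.add_apply, Finset.sum_add_distrib, hsymm,
    hG.pderiv_raise_ricci_apply hy, add_zero]
  congr 1
  · exact Finset.sum_comm
  · rw [Finset.sum_comm]
    refine Finset.sum_congr rfl fun m _ => ?_
    simp only [Matrix.mul_apply, hG.raise_ricci_apply hy, Finset.mul_sum, Matrix.transpose_apply]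
    rw [Finset.sum_comm]
    simp only [mul_comm]

theorem sum_covCurvUp_divergence_swap (hG : IsMetricOn U G) (hy : y ∈ U) (j : Fin n) :
    ∑ i, ∑ m, covCurvUp G i j m y i m = ∑ i, ∑ m, covCurvUp G m i j y i m := by
  rw [Finset.sum_comm]
  refine Finset.sum_congr rfl fun i _ => Finset.sum_congr rfl fun m _ => ?_
  rw [hG.covCurvUp_antisymm hy, covCurvUp_swap, Matrix.neg_apply, neg_neg]

theorem sum_covCurvUp_scalar (hG : IsMetricOn U G) (hy : y ∈ U) (j : Fin n) :
    ∑ i, ∑ m, covCurvUp G j m i y i m = -((pderiv j (raise G (ricci G)) y).trace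
      + 2 * (connMat G j y * raise G (ricci G) y).trace) := by
  have hleft : ∑ i, ∑ m, (connMat G j y * curvUp G i m y) i m =
      (connMat G j y * raise G (ricci G) y).trace := by
    simp only [Matrix.trace, Matrix.diag_apply, Matrix.mul_apply, hG.raise_ricci_apply hy,
      Finset.mul_sum]
    refine Finset.sum_congr rfl fun i _ => ?_
    rw [Finset.sum_comm]
    refine Finset.sum_congr rfl fun l _ => Finset.sum_congr rfl fun m _ => ?_
    rw [hG.curvUp_antisymm hy, curvUp, curvature_swap, neg_mul, Matrix.neg_apply, neg_neg, curvUp]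
  have hright : ∑ i, ∑ m, (curvUp G i m y * (connMat G j y)ᵀ) i m =
      (connMat G j y * raise G (ricci G) y).trace := by
    rw [Finset.sum_comm]
    simp only [Matrix.trace, Matrix.diag_apply, Matrix.mul_apply, hG.raise_ricci_apply hy,
      Finset.mul_sum, Matrix.transpose_apply]
    refine Finset.sum_congr rfl fun m _ => ?_
    rw [Finset.sum_comm]
    simp only [mul_comm]
  have hderiv : ∑ i, ∑ m, pderiv j (curvUp G i m) y i m =
      (pderiv j (raise G (ricci G)) y).trace := by
    simp only [Matrix.trace, Matrix.diag_apply, hG.pderiv_raise_ricci_apply hy]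
    exact Finset.sum_comm
  have hswap (i m : Fin n) : covCurvUp G j m i y i m = -covCurvUp G j i m y i m := by
    rw [covCurvUp_swap, Matrix.neg_apply]
  simp only [hswap, hG.covCurvUp_eq hy, Matrix.add_apply, Finset.sum_add_distrib,
    Finset.sum_neg_distrib, hleft, hright, hderiv]
  ring

theorem sum_covDeriv_raise_ricci (hG : IsMetricOn U G) (hy : y ∈ U) (j : Fin n) :
    ∑ m, covDeriv (connMat G) m (raise G (ricci G)) y m j =
      ∑ m, (pderiv m (raise G (ricci G)) y + connMat G m y * raise G (ricci G) y) m j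
        - (connMat G j y * raise G (ricci G) y).trace := by
  have htrace : ∑ m, (raise G (ricci G) y * connMat G m y) m j =
      (connMat G j y * raise G (ricci G) y).trace := by
    rw [Matrix.trace_mul_comm]
    simp only [Matrix.trace, Matrix.diag_apply, Matrix.mul_apply]
    refine Finset.sum_congr rfl fun m _ => Finset.sum_congr rfl fun l _ => ?_
    exact congrArg _ (hG.christoffel_symm hy l m j)
  rw [← htrace, ← Finset.sum_sub_distrib]
  rfl

theorem two_mul_divergence_ricci (hG : IsMetricOn U G) (hy : y ∈ U) (j : Fin n) :
    2 * divergence G (ricci G) j y = -pd j (trace G (ricci G)) y := by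
  have hρ := hG.differentiableAt hy (hG.contDiffOn_raise hG.contDiffOn_ricci)
  have hRic := hG.differentiableAt hy (contDiffOn_compMat hG.contDiffOn_ricci)
  have hpd : pd j (trace G (ricci G)) y = (pderiv j (raise G (ricci G)) y).trace := by
    rw [← pderiv_trace hρ]
    exact pderiv_congr ((hG.eventually_mem hy).mono fun z hz => hG.trace_eq_trace_raise hz _) j
  have bianchi (i m : Fin n) :
      covCurvUp G m i j y i m + covCurvUp G i j m y i m + covCurvUp G j m i y i m = 0 := by
    have h := covDeriv_curvature_cyclic (hG.contDiffAt_connMat hy) m i j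
    have h' := congrArg (· * invMat G y) h
    simp only [add_mul, zero_mul] at h'
    exact congrFun₂ h' i m
  have contracted := Finset.sum_congr rfl fun i (_ : i ∈ Finset.univ) =>
    Finset.sum_congr rfl fun m (_ : m ∈ Finset.univ) => bianchi i m
  simp only [Finset.sum_add_distrib, Finset.sum_const_zero, hG.sum_covCurvUp_divergence_swap hy,
    hG.sum_covCurvUp_divergence hy, hG.sum_covCurvUp_scalar hy] at contracted
  rw [hG.divergence_eq_neg_sum_covDeriv hy hRic, hG.sum_covDeriv_raise_ricci hy, hpd]
  simp only [Matrix.add_apply, Finset.sum_add_distrib] at contracted ⊢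
  linarith

end IsMetricOn

end ContractedBianchi

/-! ## The Lie derivative of the Levi-Civita connection -/

section LieDerivative

open scoped Matrix Matrix.Norms.Operator

variable {n : ℕ} {U : Set (Coord n)} {G : Fin n → Fin n → Coord n → ℝ} {ξ θ : Fin n → Coord n → ℝ}
  {y : Coord n}

/-- The Jacobian matrix `∂_i ξ^l`, with row index `l`. -/
def jac (ξ : Fin n → Coord n → ℝ) (y : Coord n) : Matrix (Fin n) (Fin n) ℝ :=
  Matrix.of fun l i => pd i (ξ l) y

/-- The covariant derivative `∇_i ξ^l = ∂_i ξ^l + ξ^m Γ^l_{mi}` of a vector field, as a matrix in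
`l, i`. -/
def gradVec (G : Fin n → Fin n → Coord n → ℝ) (ξ : Fin n → Coord n → ℝ) (y : Coord n) :
    Matrix (Fin n) (Fin n) ℝ :=
  jac ξ y + ∑ m, ξ m y • connMat G m y

/-- The Lie derivative `(L_ξ Γ)^k_{ij} = ∂_i ∂_j ξ^k + Γ^k_{im} ∂_j ξ^m - Γ^m_{ij} ∂_m ξ^k
+ ξ^m ∂_m Γ^k_{ij} + Γ^k_{mj} ∂_i ξ^m` of the Levi-Civita connection, as a matrix in `k, j`. -/
def lieConn (G : Fin n → Fin n → Coord n → ℝ) (ξ : Fin n → Coord n → ℝ) (i : Fin n)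
    (y : Coord n) : Matrix (Fin n) (Fin n) ℝ :=
  covDeriv (connMat G) i (jac ξ) y
    + ∑ m, (ξ m y • pderiv m (connMat G i) y + pd i (ξ m) y • connMat G m y)

/-- The metric trace `g^{ij} (L_ξ Γ)^k_{ij}`. -/
def traceLieConn (G : Fin n → Fin n → Coord n → ℝ) (ξ : Fin n → Coord n → ℝ) (k : Fin n)
    (y : Coord n) : ℝ :=
  ∑ i, ∑ j, ginv G i j y * lieConn G ξ i y k j

theorem trace_covDeriv (A : Fin n → Coord n → Matrix (Fin n) (Fin n) ℝ)
    (V : Coord n → Matrix (Fin n) (Fin n) ℝ) (i : Fin n) :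
    (covDeriv A i V y).trace = (pderiv i V y).trace := by
  rw [covDeriv, Matrix.trace_sub, Matrix.trace_add, Matrix.trace_mul_comm (A i y),
    add_sub_cancel_right]

theorem divergence_const_mul {φ : Fin n → Fin n → Coord n → ℝ}
    (hφ : ∀ i j, DifferentiableAt ℝ (φ i j) y) (c : ℝ) (j : Fin n) :
    divergence G (fun i j z => c * φ i j z) j y = c * divergence G φ j y := by
  have hpd (i k j : Fin n) : pd i (fun z => c * φ k j z) y = c * pd i (φ k j) y := by
    simp [pd, fderiv_const_mul (hφ k j)]
  simp only [divergence, hpd, Finset.mul_sum, mul_neg, mul_sub]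
  simp only [mul_left_comm _ c]

theorem trace_const_mul (φ : Fin n → Fin n → Coord n → ℝ) (c : ℝ) :
    trace G (fun i j z => c * φ i j z) y = c * trace G φ y := by
  simp only [trace, Finset.mul_sum, mul_left_comm _ c]

theorem contDiffOn_jac (hU : IsOpen U) (hξ : ∀ i, ContDiffOn ℝ ∞ (ξ i) U) :
    ContDiffOn ℝ ∞ (jac ξ) U :=
  contDiffOn_matrix.2 fun l i => contDiffOn_pderiv hU (hξ l) i

theorem compMat_lieMetric (hG : DifferentiableAt ℝ (compMat G) y) (ξ : Fin n → Coord n → ℝ) :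
    compMat (lieMetric G ξ) y = ∑ l, ξ l y • pderiv l (compMat G) y
      + (jac ξ y)ᵀ * compMat G y + compMat G y * jac ξ y := by
  ext i j
  simp only [Matrix.add_apply, Matrix.sum_apply, Matrix.mul_apply, Matrix.smul_apply, smul_eq_mul,
    pderiv_apply hG, Matrix.transpose_apply, mul_comm (jac ξ y _ i)]
  rw [← Finset.sum_add_distrib, ← Finset.sum_add_distrib]
  rfl

namespace IsMetricOn

theorem trace_metricAdjoint (hG : IsMetricOn U G) (hy : y ∈ U)
    (V : Coord n → Matrix (Fin n) (Fin n) ℝ) : (metricAdjoint G V y).trace = (V y).trace := by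
  rw [metricAdjoint, Matrix.trace_mul_comm, ← mul_assoc, hG.compMat_mul_invMat hy, one_mul,
    Matrix.trace_transpose]

theorem trace_curvature (hG : IsMetricOn U G) (hy : y ∈ U) (i j : Fin n) :
    (curvature (connMat G) i j y).trace = 0 := by
  have h := hG.trace_metricAdjoint hy (curvature (connMat G) i j)
  rw [hG.metricAdjoint_curvature hy, Matrix.trace_neg] at h
  linarith

theorem contDiffOn_gradVec (hG : IsMetricOn U G) (hξ : ∀ i, ContDiffOn ℝ ∞ (ξ i) U) :
    ContDiffOn ℝ ∞ (gradVec G ξ) U :=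
  (contDiffOn_jac hG.isOpen hξ).add
    (ContDiffOn.sum fun m _ => (hξ m).smul (hG.contDiffOn_connMat m))

theorem contDiffOn_lieMetric (hG : IsMetricOn U G) (hξ : ∀ i, ContDiffOn ℝ ∞ (ξ i) U)
    (i j : Fin n) : ContDiffOn ℝ ∞ (lieMetric G ξ i j) U := by
  have hpdG (l) : ContDiffOn ℝ ∞ (pd l (G i j)) U := contDiffOn_pderiv hG.isOpen (hG.smooth i j) l
  have hpdξ (m l) : ContDiffOn ℝ ∞ (pd m (ξ l)) U := contDiffOn_pderiv hG.isOpen (hξ l) m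
  exact ContDiffOn.sum fun l _ => (((hξ l).mul (hpdG l)).add
    ((hG.smooth l j).mul (hpdξ i l))).add ((hG.smooth i l).mul (hpdξ j l))

theorem contDiffOn_sharp (hG : IsMetricOn U G) (hθ : ∀ i, ContDiffOn ℝ ∞ (θ i) U) (i : Fin n) :
    ContDiffOn ℝ ∞ (sharp G θ i) U :=
  ContDiffOn.sum fun j _ => (contDiffOn_matrix.1 hG.contDiffOn_invMat i j).mul (hθ j)

theorem contDiffOn_deltaStar (hG : IsMetricOn U G) (hθ : ∀ i, ContDiffOn ℝ ∞ (θ i) U)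
    (i j : Fin n) : ContDiffOn ℝ ∞ (deltaStar G θ i j) U :=
  contDiffOn_const.mul (hG.contDiffOn_lieMetric (hG.contDiffOn_sharp hθ) i j)

theorem raise_lieMetric (hG : IsMetricOn U G) (hy : y ∈ U) (ξ : Fin n → Coord n → ℝ) :
    raise G (lieMetric G ξ) y = gradVec G ξ y + metricAdjoint G (gradVec G ξ) y := by
  have lowered : compMat (lieMetric G ξ) y =
      compMat G y * gradVec G ξ y + (gradVec G ξ y)ᵀ * compMat G y := by
    rw [compMat_lieMetric (hG.differentiableAt hy (contDiffOn_compMat hG.smooth))]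
    simp only [hG.pderiv_compMat hy, gradVec, Matrix.transpose_add, Matrix.transpose_sum,
      Matrix.transpose_smul, mul_add, add_mul, Finset.mul_sum, Finset.sum_mul, smul_add,
      Finset.sum_add_distrib, Matrix.mul_smul, Matrix.smul_mul]
    abel
  rw [raise, lowered, metricAdjoint, mul_add, ← mul_assoc, ← mul_assoc, hG.invMat_mul_compMat hy,
    one_mul]

theorem pderiv_gradVec (hG : IsMetricOn U G) (hy : y ∈ U) (hξ : ∀ i, ContDiffOn ℝ ∞ (ξ i) U)
    (i : Fin n) : pderiv i (gradVec G ξ) y = pderiv i (jac ξ) y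
      + ∑ m, (ξ m y • pderiv i (connMat G m) y + pd i (ξ m) y • connMat G m y) := by
  have hA (m) := hG.differentiableAt hy (hG.contDiffOn_connMat m)
  have hξ' (m) := hG.differentiableAt hy (hξ m)
  rw [show gradVec G ξ = fun z => jac ξ z + ∑ m, ξ m z • connMat G m z from rfl,
    pderiv_add (hG.differentiableAt hy (contDiffOn_jac hG.isOpen hξ))
      (DifferentiableAt.fun_sum fun m _ => (hξ' m).fun_smul (hA m)),
    pderiv_sum fun m _ => (hξ' m).fun_smul (hA m)]
  simp only [pderiv_smul (hξ' _) (hA _), pd_eq_pderiv]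

theorem lieConn_eq_covDeriv_gradVec (hG : IsMetricOn U G) (hy : y ∈ U)
    (hξ : ∀ i, ContDiffOn ℝ ∞ (ξ i) U) (i : Fin n) :
    lieConn G ξ i y = covDeriv (connMat G) i (gradVec G ξ) y
      + ∑ m, ξ m y • curvature (connMat G) m i y := by
  rw [lieConn, covDeriv, covDeriv, hG.pderiv_gradVec hy hξ]
  simp only [curvature, gradVec, mul_add, add_mul, Finset.mul_sum, Finset.sum_mul,
    Matrix.mul_smul, Matrix.smul_mul, smul_add, smul_sub, Finset.sum_add_distrib,
    Finset.sum_sub_distrib]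
  abel

/-- The curvature term of `L_ξ Γ` is skew-adjoint, so it drops out of the symmetrization. -/
theorem covDeriv_raise_lieMetric (hG : IsMetricOn U G) (hy : y ∈ U)
    (hξ : ∀ i, ContDiffOn ℝ ∞ (ξ i) U) (i : Fin n) :
    covDeriv (connMat G) i (raise G (lieMetric G ξ)) y =
      lieConn G ξ i y + metricAdjoint G (lieConn G ξ i) y := by
  have hgrad := hG.differentiableAt hy (hG.contDiffOn_gradVec hξ)
  have hadj : DifferentiableAt ℝ (metricAdjoint G (gradVec G ξ)) y :=
    ((hG.differentiableAt hy hG.contDiffOn_invMat).fun_mul (differentiableAt_transpose hgrad))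
      |>.fun_mul (hG.differentiableAt hy (contDiffOn_compMat hG.smooth))
  have hlie : metricAdjoint G (lieConn G ξ i) y =
      metricAdjoint G (covDeriv (connMat G) i (gradVec G ξ)) y
        + ∑ m, ξ m y • metricAdjoint G (curvature (connMat G) m i) y := by
    simp only [metricAdjoint, hG.lieConn_eq_covDeriv_gradVec hy hξ, Matrix.transpose_add,
      Matrix.transpose_sum, Matrix.transpose_smul, mul_add, add_mul, Finset.mul_sum,
      Finset.sum_mul, Matrix.mul_smul, Matrix.smul_mul]
  rw [covDeriv_congr ((hG.eventually_mem hy).mono fun z hz => hG.raise_lieMetric hz ξ),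
    covDeriv_add hgrad hadj, hG.covDeriv_metricAdjoint hy hgrad, hlie,
    hG.lieConn_eq_covDeriv_gradVec hy hξ]
  simp only [hG.metricAdjoint_curvature hy, smul_neg, Finset.sum_neg_distrib]
  abel

theorem lieConn_apply (hG : IsMetricOn U G) (hy : y ∈ U) (hξ : ∀ i, ContDiffOn ℝ ∞ (ξ i) U)
    (i k j : Fin n) : lieConn G ξ i y k j =
      pd i (pd j (ξ k)) y + ∑ m, christoffel G k i m y * pd j (ξ m) y
        - ∑ m, christoffel G m i j y * pd m (ξ k) y
        + ∑ m, (ξ m y * pd m (christoffel G k i j) y + pd i (ξ m) y * christoffel G k m j y) := by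
  have hjac := hG.differentiableAt hy (contDiffOn_jac hG.isOpen hξ)
  have hA := hG.differentiableAt hy (hG.contDiffOn_connMat i)
  simp only [lieConn, covDeriv, Matrix.add_apply, Matrix.sub_apply, Matrix.mul_apply,
    Matrix.sum_apply, Matrix.smul_apply, smul_eq_mul, pderiv_apply hjac, pderiv_apply hA,
    mul_comm (jac ξ y k _)]
  rfl

theorem lieConn_symm (hG : IsMetricOn U G) (hy : y ∈ U) (hξ : ∀ i, ContDiffOn ℝ ∞ (ξ i) U)
    (k i j : Fin n) : lieConn G ξ i y k j = lieConn G ξ j y k i := by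
  have hcomm : pd i (pd j (ξ k)) y = pd j (pd i (ξ k)) y :=
    pderiv_comm (((hξ k).contDiffAt (hG.eventually_mem hy)).of_le (by norm_cast)) i j
  have hΓ (m) : pd m (christoffel G k i j) y = pd m (christoffel G k j i) y :=
    pderiv_congr ((hG.eventually_mem hy).mono fun z hz => hG.christoffel_symm hz k i j) m
  have hswap (a b : Fin n) : ∑ m, christoffel G k a m y * pd b (ξ m) y =
      ∑ m, pd b (ξ m) y * christoffel G k m a y :=
    Finset.sum_congr rfl fun m _ => by rw [hG.christoffel_symm hy k a m, mul_comm]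
  simp only [hG.lieConn_apply hy hξ, Finset.sum_add_distrib, hcomm, hΓ, hswap,
    hG.christoffel_symm hy _ i j]
  ring

theorem trace_lieConn (hG : IsMetricOn U G) (hy : y ∈ U) (hξ : ∀ i, ContDiffOn ℝ ∞ (ξ i) U)
    (j : Fin n) : (lieConn G ξ j y).trace = pd j (fun z => (gradVec G ξ z).trace) y := by
  rw [hG.lieConn_eq_covDeriv_gradVec hy hξ, Matrix.trace_add, trace_covDeriv,
    pderiv_trace (hG.differentiableAt hy (hG.contDiffOn_gradVec hξ)), Matrix.trace_sum]
  simp [hG.trace_curvature hy]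

theorem gradVec_apply (hG : IsMetricOn U G) (hy : y ∈ U) (ξ : Fin n → Coord n → ℝ) (l i : Fin n) :
    gradVec G ξ y l i = pd i (ξ l) y + (connMat G i y *ᵥ fun m => ξ m y) l := by
  simp only [gradVec, Matrix.add_apply, Matrix.sum_apply, Matrix.smul_apply, smul_eq_mul,
    Matrix.mulVec, dotProduct]
  congr 1
  exact Finset.sum_congr rfl fun m _ => by
    rw [mul_comm, connMat, connMat, Matrix.of_apply, Matrix.of_apply, hG.christoffel_symm hy]

theorem gradVec_sharp_apply (hG : IsMetricOn U G) (hy : y ∈ U)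
    (hθ : ∀ i, ContDiffOn ℝ ∞ (θ i) U) (l i : Fin n) : gradVec G (sharp G θ) y l i =
      ∑ j, ginv G l j y * (pd i (θ j) y - ∑ k, christoffel G k i j y * θ k y) := by
  have hinv := hG.differentiableAt hy hG.contDiffOn_invMat
  have hpd : pd i (sharp G θ l) y = (pderiv i (invMat G) y *ᵥ (fun j => θ j y)) l
      + (invMat G y *ᵥ fun j => pd i (θ j) y) l := by
    have hentry (j) := hG.differentiableAt hy (contDiffOn_matrix.1 hG.contDiffOn_invMat l j)
    have hθ' (j) := hG.differentiableAt hy (hθ j)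
    simp only [Matrix.mulVec, dotProduct, pderiv_apply hinv, ← Finset.sum_add_distrib]
    rw [show sharp G θ l = fun z => ∑ j, invMat G z l j * θ j z from rfl, pd_eq_pderiv,
      pderiv_sum fun j _ => (hentry j).fun_mul (hθ' j)]
    exact Finset.sum_congr rfl fun j _ => pderiv_mul (hentry j) (hθ' j) i
  have hsharp : (fun m => sharp G θ m y) = invMat G y *ᵥ fun j => θ j y := rfl
  have parallel : gradVec G (sharp G θ) y l i = (invMat G y *ᵥ
      ((fun j => pd i (θ j) y) - (connMat G i y)ᵀ *ᵥ fun j => θ j y)) l := by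
    rw [hG.gradVec_apply hy, hpd, hG.pderiv_invMat hy, hsharp]
    simp only [Matrix.mulVec_sub, Matrix.neg_mulVec, Matrix.add_mulVec, Matrix.mulVec_mulVec,
      Pi.add_apply, Pi.sub_apply, Pi.neg_apply]
    ring
  exact parallel

theorem codiff_eq_neg_trace_gradVec (hG : IsMetricOn U G) (hy : y ∈ U)
    (hθ : ∀ i, ContDiffOn ℝ ∞ (θ i) U) : codiff G θ y = -(gradVec G (sharp G θ) y).trace := by
  simp only [codiff, Matrix.trace, Matrix.diag_apply, hG.gradVec_sharp_apply hy hθ]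

theorem trace_deltaStar (hG : IsMetricOn U G) (hy : y ∈ U) (hθ : ∀ i, ContDiffOn ℝ ∞ (θ i) U) :
    trace G (deltaStar G θ) y = -codiff G θ y := by
  have h : trace G (deltaStar G θ) y = 1 / 2 * trace G (lieMetric G (sharp G θ)) y :=
    trace_const_mul _ _
  rw [h, hG.trace_eq_trace_raise hy, hG.raise_lieMetric hy, Matrix.trace_add,
    hG.trace_metricAdjoint hy, hG.codiff_eq_neg_trace_gradVec hy hθ]
  ring

theorem divergence_lieMetric (hG : IsMetricOn U G) (hy : y ∈ U)
    (hξ : ∀ i, ContDiffOn ℝ ∞ (ξ i) U) (j : Fin n) : divergence G (lieMetric G ξ) j y =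
      -((lieConn G ξ j y).trace + ∑ k, G j k y * traceLieConn G ξ k y) := by
  rw [hG.divergence_eq_neg_sum_covDeriv hy
    (hG.differentiableAt hy (contDiffOn_compMat (hG.contDiffOn_lieMetric hξ)))]
  simp only [hG.covDeriv_raise_lieMetric hy hξ, Matrix.add_apply, Finset.sum_add_distrib]
  congr 2
  · exact Finset.sum_congr rfl fun i _ => hG.lieConn_symm hy hξ i i j
  · simp only [metricAdjoint, traceLieConn, Matrix.mul_apply, Matrix.transpose_apply,
      Finset.sum_mul, Finset.mul_sum]
    rw [Finset.sum_comm]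
    refine Finset.sum_congr rfl fun k _ => Finset.sum_congr rfl fun i _ =>
      Finset.sum_congr rfl fun a _ => ?_
    rw [mul_comm, ← hG.symm y hy k j]
    rfl

theorem sampson_eq_neg_sum_traceLieConn (hG : IsMetricOn U G) (hy : y ∈ U)
    (hθ : ∀ i, ContDiffOn ℝ ∞ (θ i) U) (j : Fin n) :
    sampson G θ j y = -∑ k, G j k y * traceLieConn G (sharp G θ) k y := by
  have hξ := hG.contDiffOn_sharp hθ
  have hdiv : divergence G (deltaStar G θ) j y =
      1 / 2 * divergence G (lieMetric G (sharp G θ)) j y :=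
    divergence_const_mul (fun a b => hG.differentiableAt hy (hG.contDiffOn_lieMetric hξ a b)) _ _
  have hcodiff : pd j (codiff G θ) y = -(lieConn G (sharp G θ) j y).trace := by
    rw [hG.trace_lieConn hy hξ, pd_eq_pderiv, pderiv_congr ((hG.eventually_mem hy).mono fun z hz =>
      hG.codiff_eq_neg_trace_gradVec hz hθ)]
    simp [pd, pderiv]
  rw [sampson, hdiv, hG.divergence_lieMetric hy hξ, hcodiff]
  ring

/-- By the contracted Bianchi identity, `2 δ Ric = -d (trace Ric)`; inserting the decomposition on
both sides leaves `2 δ δ^* θ - 2 dλ = d δ θ - n dλ`. -/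
theorem sampson_eq_of_ricci_eq (hG : IsMetricOn U G) (hθ : ∀ i, ContDiffOn ℝ ∞ (θ i) U)
    {lam : Coord n → ℝ} (hlam : ContDiffOn ℝ ∞ lam U) {φ : Fin n → Fin n → Coord n → ℝ}
    (hφ : ∀ i j, ContDiffOn ℝ ∞ (φ i j) U) (hdiv : ∀ z ∈ U, ∀ j, divergence G φ j z = 0)
    (htr : ∀ z ∈ U, trace G φ z = 0)
    (hRic : ∀ z ∈ U, ∀ i j, ricci G i j z =
      (deltaStar G θ i j z + lam z * G i j z) + φ i j z) (hy : y ∈ U) (j : Fin n) :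
    sampson G θ j y = -((n : ℝ) - 2) * pd j lam y := by
  have hδ (a b) := hG.differentiableAt hy (hG.contDiffOn_deltaStar hθ a b)
  have hlamG (a b) := hG.differentiableAt hy (hlam.mul (hG.smooth a b))
  have divergence_ricci : divergence G (ricci G) j y =
      divergence G (deltaStar G θ) j y - pd j lam y := by
    rw [divergence_congr fun a b => (hG.eventually_mem hy).mono fun z hz => hRic z hz a b,
      divergence_add (fun a b => (hδ a b).fun_add (hlamG a b))
        (fun a b => hG.differentiableAt hy (hφ a b)),
      divergence_add hδ hlamG, hG.divergence_smul_metric hy hlam, hdiv y hy, add_zero,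
      sub_eq_add_neg]
  have trace_ricci (z) (hz : z ∈ U) : trace G (ricci G) z = n * lam z - codiff G θ z := by
    have hsum : trace G (ricci G) z =
        trace G (fun i j z => (deltaStar G θ i j z + lam z * G i j z) + φ i j z) z := by
      simp only [trace, hRic z hz]
    rw [hsum, trace_add, trace_add, hG.trace_deltaStar hz hθ, hG.trace_smul_metric hz, htr z hz]
    ring
  have pd_trace_ricci : pd j (trace G (ricci G)) y = n * pd j lam y - pd j (codiff G θ) y := by
    have hlam' := hG.differentiableAt hy hlam
    rw [pd_eq_pderiv, pderiv_congr ((hG.eventually_mem hy).mono trace_ricci),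
      pderiv_sub (hlam'.const_mul _) (hG.differentiableAt hy (hG.contDiffOn_codiff hθ)),
      pderiv_mul (differentiableAt_const _) hlam', pderiv_const]
    simp [pd_eq_pderiv]
  have bianchi := hG.two_mul_divergence_ricci hy j
  rw [divergence_ricci, pd_trace_ricci] at bianchi
  rw [sampson]
  linarith

end IsMetricOn

end LieDerivative

/-! ## The first variation of the tension field -/

section TimeDerivatives

variable {n : ℕ} {E : Type*} [NormedAddCommGroup E] [NormedSpace ℝ E] {F : ℝ × Coord n → E}
  {η : Coord n → E} {y z : Coord n} {t : ℝ}

theorem pderiv_prodMk (hF : DifferentiableAt ℝ F (t, z)) (i : Fin n) :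
    pderiv i (fun w => F (t, w)) z = fderiv ℝ F (t, z) (0, EuclideanSpace.single i 1) := by
  have h : HasFDerivAt (fun w => F (t, w)) _ z :=
    hF.hasFDerivAt.comp z (hasFDerivAt_prodMk_right t z)
  simp [pderiv, h.fderiv]

theorem hasDerivAt_prodMk (hF : DifferentiableAt ℝ F (t, z)) :
    HasDerivAt (fun s => F (s, z)) (fderiv ℝ F (t, z) (1, 0)) t := by
  have h : HasFDerivAt (fun s => F (s, z)) _ t :=
    hF.hasFDerivAt.comp t (hasFDerivAt_prodMk_left t z)
  simpa using h.hasDerivAt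

theorem eventually_pderiv_prodMk {p : ℝ × Coord n} (hF : ContDiffAt ℝ 1 F p) (i : Fin n) :
    (fun q : ℝ × Coord n => pderiv i (fun w => F (q.1, w)) q.2) =ᶠ[𝓝 p]
      fun q => fderiv ℝ F q (0, EuclideanSpace.single i 1) :=
  (hF.eventually (by simp)).mono fun _ hq => pderiv_prodMk (hq.differentiableAt (by simp)) i

theorem contDiffAt_pderiv_prodMk {p : ℝ × Coord n} {k N : WithTop ℕ∞} (hF : ContDiffAt ℝ N F p)
    (hk : k + 1 ≤ N) (i : Fin n) :
    ContDiffAt ℝ k (fun q : ℝ × Coord n => pderiv i (fun w => F (q.1, w)) q.2) p :=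
  ((hF.fderiv_right hk).clm_apply contDiffAt_const).congr_of_eventuallyEq
    (eventually_pderiv_prodMk (hF.of_le (le_add_self.trans hk)) i)

theorem fderiv_fderiv_apply_comm {X : Type*} [NormedAddCommGroup X] [NormedSpace ℝ X] {f : X → E}
    {p : X} (hf : ContDiffAt ℝ 2 f p) (v w : X) :
    fderiv ℝ (fun q => fderiv ℝ f q v) p w = fderiv ℝ (fun q => fderiv ℝ f q w) p v := by
  have hd : DifferentiableAt ℝ (fderiv ℝ f) p :=
    (hf.fderiv_right (m := 1) (by norm_num)).differentiableAt (by simp)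
  rw [fderiv_clm_apply hd (differentiableAt_const _),
    fderiv_clm_apply hd (differentiableAt_const _)]
  simpa using (hf.isSymmSndFDerivAt (by simp)).eq w v

theorem hasDerivAt_pderiv (hF : ContDiffAt ℝ 2 F (t, y))
    (hη : ∀ᶠ z in 𝓝 y, HasDerivAt (fun s => F (s, z)) (η z) t) (i : Fin n) :
    HasDerivAt (fun s => pderiv i (fun z => F (s, z)) y) (pderiv i η y) t := by
  have hF₁ : ContDiffAt ℝ 1 F (t, y) := hF.of_le one_le_two
  have hd : ∀ᶠ q in 𝓝 (t, y), DifferentiableAt ℝ F q :=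
    (hF₁.eventually (by simp)).mono fun _ hq => hq.differentiableAt (by simp)
  have hd' (v : ℝ × Coord n) : DifferentiableAt ℝ (fun q => fderiv ℝ F q v) (t, y) :=
    ((hF.fderiv_right (m := 1) (by norm_num)).differentiableAt (by simp)).clm_apply
      (differentiableAt_const v)
  have velocity : η =ᶠ[𝓝 y] fun z => fderiv ℝ F (t, z) (1, 0) := by
    filter_upwards [hη, (Continuous.prodMk_right t).continuousAt.eventually hd] with z hz hdz
    exact hz.unique (hasDerivAt_prodMk hdz)
  have mixed : pderiv i η y =
      fderiv ℝ (fun q => fderiv ℝ F q (0, EuclideanSpace.single i 1)) (t, y) (1, 0) := by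
    rw [fderiv_fderiv_apply_comm hF, ← pderiv_prodMk (hd' _), pderiv_congr velocity]
  rw [mixed]
  exact (hasDerivAt_prodMk (hd' _)).congr_of_eventuallyEq
    ((Continuous.prodMk_left y).continuousAt.eventually (eventually_pderiv_prodMk hF₁ i))

theorem hasDerivAt_pderiv_pderiv (hF : ContDiffAt ℝ 3 F (t, y))
    (hη : ∀ᶠ z in 𝓝 y, HasDerivAt (fun s => F (s, z)) (η z) t) (i j : Fin n) :
    HasDerivAt (fun s => pderiv i (pderiv j fun z => F (s, z)) y) (pderiv i (pderiv j η) y) t := by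
  have hF₂ : ∀ᶠ z in 𝓝 y, ContDiffAt ℝ 2 F (t, z) :=
    (Continuous.prodMk_right t).continuousAt.eventually
      ((hF.of_le (by norm_cast)).eventually (by simp))
  refine hasDerivAt_pderiv (contDiffAt_pderiv_prodMk hF (by norm_num) j) ?_ i
  filter_upwards [hF₂, hη.eventually_nhds] with z hz hηz
  exact hasDerivAt_pderiv hz hηz j

end TimeDerivatives

section Variation

variable {n : ℕ} {U : Set (Coord n)} {G : Fin n → Fin n → Coord n → ℝ} {ξ θ : Fin n → Coord n → ℝ}
  {Φ : ℝ → Coord n → Coord n} {y : Coord n}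

theorem fderiv_eq_sum_pd (f : Coord n → ℝ) (y v : Coord n) :
    fderiv ℝ f y v = ∑ m, v m * pd m f y := by
  have hv : v = ∑ m, v m • EuclideanSpace.single m (1 : ℝ) := by
    ext k
    simp [Pi.single_apply]
  conv_lhs => rw [hv]
  simp [pd]

theorem pd_coord (i a : Fin n) (y : Coord n) :
    pd i (fun z : Coord n => z a) y = if a = i then 1 else 0 := by
  have h : HasFDerivAt (fun z : Coord n => z a) (EuclideanSpace.proj (𝕜 := ℝ) a) y :=
    (EuclideanSpace.proj (𝕜 := ℝ) a : Coord n →L[ℝ] ℝ).hasFDerivAt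
  simp [pd, h.fderiv]

namespace IsLocalFamily

theorem congr {ξ' : Fin n → Coord n → ℝ} (h : IsLocalFamily ξ Φ y)
    (hξ : ∀ᶠ z in 𝓝 y, ∀ k, ξ k z = ξ' k z) : IsLocalFamily ξ' Φ y := by
  refine ⟨h.1, ?_⟩
  filter_upwards [h.2, hξ] with z hz hξz
  exact ⟨hz.1, fun k => hξz k ▸ hz.2 k⟩

theorem contDiffAt_apply (h : IsLocalFamily ξ Φ y) (k : Fin n) :
    ContDiffAt ℝ ∞ (fun p : ℝ × Coord n => Φ p.1 p.2 k) (0, y) :=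
  (EuclideanSpace.proj (𝕜 := ℝ) k : Coord n →L[ℝ] ℝ).contDiff.contDiffAt.comp _ h.1

theorem eventually_hasDerivAt_apply (h : IsLocalFamily ξ Φ y) (k : Fin n) :
    ∀ᶠ z in 𝓝 y, HasDerivAt (fun t => Φ t z k) (ξ k z) 0 :=
  h.2.mono fun _ hz => hz.2 k

theorem zero_apply (h : IsLocalFamily ξ Φ y) : Φ 0 y = y :=
  h.2.self_of_nhds.1

theorem pd_zero_apply (h : IsLocalFamily ξ Φ y) (i a : Fin n) :
    pd i (fun z => Φ 0 z a) y = if a = i then 1 else 0 := by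
  have hid : (fun z => Φ 0 z a) =ᶠ[𝓝 y] fun z => z a := h.2.mono fun z hz => by simp only [hz.1]
  rw [← pd_coord i a y, pd_eq_pderiv, pderiv_congr hid, pd_eq_pderiv]

theorem hasDerivAt_pd (h : IsLocalFamily ξ Φ y) (i a : Fin n) :
    HasDerivAt (fun t => pd i (fun z => Φ t z a) y) (pd i (ξ a) y) 0 :=
  hasDerivAt_pderiv (F := fun p => Φ p.1 p.2 a) ((h.contDiffAt_apply a).of_le (by norm_cast))
    (h.eventually_hasDerivAt_apply a) i

theorem hasDerivAt_pd_pd (h : IsLocalFamily ξ Φ y) (i j a : Fin n) :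
    HasDerivAt (fun t => pd i (pd j fun z => Φ t z a) y) (pd i (pd j (ξ a)) y) 0 :=
  hasDerivAt_pderiv_pderiv (F := fun p => Φ p.1 p.2 a)
    ((h.contDiffAt_apply a).of_le (by norm_cast)) (h.eventually_hasDerivAt_apply a) i j

theorem hasDerivAt_comp (h : IsLocalFamily ξ Φ y) {f : Coord n → ℝ}
    (hf : DifferentiableAt ℝ f y) :
    HasDerivAt (fun t => f (Φ t y)) (∑ m, ξ m y * pd m f y) 0 := by
  have hΦ : HasDerivAt (fun t => Φ t y) (WithLp.toLp 2 fun m => ξ m y) 0 :=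
    (EuclideanSpace.equiv (Fin n) ℝ).symm.hasFDerivAt.comp_hasDerivAt 0 <|
      hasDerivAt_pi.2 fun m => (h.eventually_hasDerivAt_apply m).self_of_nhds
  rw [← h.zero_apply] at hf
  have hcomp := hf.hasFDerivAt.comp_hasDerivAt 0 hΦ
  rwa [h.zero_apply, fderiv_eq_sum_pd] at hcomp

theorem hasDerivAt_sum_mul_pd_mul_pd (h : IsLocalFamily ξ Φ y) {B : Fin n → Fin n → Coord n → ℝ}
    (hB : ∀ a b, DifferentiableAt ℝ (B a b) y) (i j : Fin n) :
    HasDerivAt (fun t => ∑ a, ∑ b, B a b (Φ t y) * pd i (fun z => Φ t z a) y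
        * pd j (fun z => Φ t z b) y)
      (∑ m, ξ m y * pd m (B i j) y + ∑ a, pd i (ξ a) y * B a j y
        + ∑ b, B i b y * pd j (ξ b) y) 0 := by
  have leibniz := HasDerivAt.fun_sum (u := Finset.univ) fun a _ =>
    HasDerivAt.fun_sum (u := Finset.univ) fun b _ =>
      ((h.hasDerivAt_comp (hB a b)).fun_mul (h.hasDerivAt_pd i a)).fun_mul (h.hasDerivAt_pd j b)
  refine leibniz.congr_deriv ?_
  simp only [h.pd_zero_apply, h.zero_apply, mul_ite, mul_one, mul_zero, ite_mul, zero_mul,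
    Finset.sum_add_distrib, Finset.sum_ite_eq', Finset.mem_univ, if_true,
    Finset.sum_ite_irrel, Finset.sum_const_zero, mul_comm (B _ j y)]

end IsLocalFamily

theorem isLocalFamily_add_smul (hU : IsOpen U) (hξ : ∀ i, ContDiffOn ℝ ∞ (ξ i) U) (hy : y ∈ U) :
    IsLocalFamily ξ (fun t z => z + t • WithLp.toLp 2 fun k => ξ k z) y := by
  refine ⟨contDiffAt_snd.add (contDiffAt_fst.smul (contDiffAt_euclidean.2 fun k => ?_)),
    Eventually.of_forall fun z => ⟨by simp, fun k => ?_⟩⟩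
  · exact ((hξ k).contDiffAt (hU.mem_nhds hy)).comp ((0 : ℝ), y) contDiffAt_snd
  · simpa using ((hasDerivAt_id (0 : ℝ)).mul_const (ξ k z)).const_add (z k)

namespace IsMetricOn

theorem hasDerivAt_tension (hG : IsMetricOn U G) (hy : y ∈ U)
    (hξ : ∀ i, ContDiffOn ℝ ∞ (ξ i) U) (h : IsLocalFamily ξ Φ y) (k : Fin n) :
    HasDerivAt (fun t => tension G (Φ t) k y) (traceLieConn G ξ k y) 0 := by
  refine HasDerivAt.fun_sum fun i _ => HasDerivAt.fun_sum fun j _ => HasDerivAt.const_mul _ ?_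
  have hΓ (a b) := hG.differentiableAt hy (hG.contDiffOn_christoffel k a b)
  have hlin : HasDerivAt (fun t => ∑ l, christoffel G l i j y * pd l (fun z => Φ t z k) y)
      (∑ l, christoffel G l i j y * pd l (ξ k) y) 0 :=
    HasDerivAt.fun_sum fun l _ => (h.hasDerivAt_pd l k).const_mul _
  refine (((h.hasDerivAt_pd_pd i j k).fun_sub hlin).fun_add
    (h.hasDerivAt_sum_mul_pd_mul_pd hΓ i j)).congr_deriv ?_
  rw [hG.lieConn_apply hy hξ, Finset.sum_add_distrib]
  ring

theorem forall_hasDerivAt_tension_zero_iff (hG : IsMetricOn U G) (hy : y ∈ U)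
    (hξ : ∀ i, ContDiffOn ℝ ∞ (ξ i) U) :
    (∀ Φ, IsLocalFamily ξ Φ y → ∀ k, HasDerivAt (fun t => tension G (Φ t) k y) 0 0) ↔
      ∀ k, traceLieConn G ξ k y = 0 := by
  refine ⟨fun h k => ?_, fun h Φ hΦ k => h k ▸ hG.hasDerivAt_tension hy hξ hΦ k⟩
  have hΦ := isLocalFamily_add_smul hG.isOpen hξ hy
  exact (hG.hasDerivAt_tension hy hξ hΦ k).unique (h _ hΦ k)

theorem forall_sampson_eq_zero_iff (hG : IsMetricOn U G) (hy : y ∈ U)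
    (hθ : ∀ i, ContDiffOn ℝ ∞ (θ i) U) :
    (∀ j, sampson G θ j y = 0) ↔ ∀ k, traceLieConn G (sharp G θ) k y = 0 := by
  simp only [hG.sampson_eq_neg_sum_traceLieConn hy hθ, neg_eq_zero]
  refine ⟨fun h => congrFun (Matrix.eq_zero_of_mulVec_eq_zero (hG.isUnit_det y hy).ne_zero
    (funext h)), fun h j => by simp [h]⟩

end IsMetricOn

end Variation

/-! ## Components in smooth charts -/

section Components

variable {n : ℕ} {M : Type*} [TopologicalSpace M] [ChartedSpace (Coord n) M]
  {e : OpenPartialHomeomorph M (Coord n)} {y : Coord n}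

theorem sum_smul_frame (e : OpenPartialHomeomorph M (Coord n)) (y : Coord n) (c : Fin n → ℝ) :
    ∑ i, c i • frame e i y = mfderiv (𝓡 n) (𝓡 n) e.symm y (WithLp.toLp 2 c : Coord n) := by
  have hc : (WithLp.toLp 2 c : Coord n) = ∑ m, c m • EuclideanSpace.single m (1 : ℝ) := by
    ext k
    simp [Pi.single_apply]
  have map_sum_smul (L : Coord n →L[ℝ] TangentSpace (𝓡 n) (e.symm y)) :
      L (∑ m, c m • EuclideanSpace.single m (1 : ℝ)) =
        ∑ m, c m • L (EuclideanSpace.single m (1 : ℝ)) := by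
    simp only [map_sum, map_smul]
  rw [hc]
  exact (map_sum_smul _).symm

theorem inner_sum_smul_frame
    (φ : Π x : M, TangentSpace (𝓡 n) x →L[ℝ] TangentSpace (𝓡 n) x →L[ℝ] ℝ) (c : Fin n → ℝ)
    (j : Fin n) :
    φ (e.symm y) (∑ i, c i • frame e i y) (frame e j y) = ∑ i, c i * tensorComp e φ i j y := by
  rw [map_sum, sum_apply]
  refine Finset.sum_congr rfl fun i _ => ?_
  rw [map_smul]
  rfl

variable [IsManifold (𝓡 n) ∞ M]

theorem mdifferentiable_of_mem_charts (he : e ∈ charts n M) : e.MDifferentiable (𝓡 n) (𝓡 n) :=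
  ⟨(contMDiffOn_of_mem_maximalAtlas he).mdifferentiableOn (by simp),
    (contMDiffOn_symm_of_mem_maximalAtlas he).mdifferentiableOn (by simp)⟩

theorem contMDiffOn_frame (he : e ∈ charts n M) (i : Fin n) :
    ContMDiffOn (𝓡 n) ((𝓡 n).prod 𝓘(ℝ, Coord n)) ∞
      (fun z => TotalSpace.mk' (Coord n) (E := fun x : M => TangentSpace (𝓡 n) x)
        (e.symm z) (frame e i z)) e.target := by
  have htangent := (contMDiffOn_symm_of_mem_maximalAtlas he).contMDiffOn_tangentMapWithin
    (m := ∞) (by simp) e.open_target.uniqueMDiffOn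
  have hconst : ContMDiff (𝓡 n) (𝓡 n).tangent ∞
      (fun z : Coord n => (⟨z, (EuclideanSpace.single i (1 : ℝ) : Coord n)⟩ :
        TangentBundle (𝓡 n) (Coord n))) :=
    fun z => contMDiffAt_vectorSpace_iff_contDiffAt.2 contDiffAt_const
  refine (htangent.comp hconst.contMDiffOn (s := e.target) fun z hz => hz).congr fun z hz => ?_
  simp only [Function.comp, tangentMapWithin, mfderivWithin_of_isOpen e.open_target hz]
  rfl

theorem contDiffOn_formComp (he : e ∈ charts n M) (θ : OneForm n M) (i : Fin n) :
    ContDiffOn ℝ ∞ (formComp e θ i) e.target := by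
  rw [← contMDiffOn_iff_contDiffOn]
  intro z hz
  have hθ := (θ.contMDiff.contMDiffAt (x := e.symm z)).comp_contMDiffWithinAt z
    (contMDiffOn_symm_of_mem_maximalAtlas he z hz)
  have happly := ContMDiffWithinAt.clm_bundle_apply (F₁ := Coord n) (F₂ := ℝ)
    (E₂ := Bundle.Trivial M ℝ) (b := e.symm) hθ (contMDiffOn_frame he i z hz)
  rw [contMDiffWithinAt_totalSpace] at happly
  exact happly.2

theorem contDiffOn_tensorComp (he : e ∈ charts n M)
    {φ : Π x : M, TangentSpace (𝓡 n) x →L[ℝ] TangentSpace (𝓡 n) x →L[ℝ] ℝ}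
    (hφ : ContMDiff (𝓡 n) ((𝓡 n).prod 𝓘(ℝ, Coord n →L[ℝ] Coord n →L[ℝ] ℝ)) ∞
      fun x => TotalSpace.mk' (Coord n →L[ℝ] Coord n →L[ℝ] ℝ)
        (E := fun x : M => TangentSpace (𝓡 n) x →L[ℝ] TangentSpace (𝓡 n) x →L[ℝ] ℝ) x (φ x))
    (i j : Fin n) : ContDiffOn ℝ ∞ (tensorComp e φ i j) e.target := by
  rw [← contMDiffOn_iff_contDiffOn]
  intro z hz
  have hφz := (hφ.contMDiffAt (x := e.symm z)).comp_contMDiffWithinAt z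
    (contMDiffOn_symm_of_mem_maximalAtlas he z hz)
  have happly := ContMDiffWithinAt.clm_bundle_apply₂ (F₁ := Coord n) (F₂ := Coord n) (F₃ := ℝ)
    (E₃ := Bundle.Trivial M ℝ) (b := e.symm) hφz (contMDiffOn_frame he i z hz)
    (contMDiffOn_frame he j z hz)
  rw [contMDiffWithinAt_totalSpace] at happly
  exact happly.2

theorem contDiffOn_comp_chart_symm (he : e ∈ charts n M) (f : C^∞⟮𝓡 n, M; ℝ⟯) :
    ContDiffOn ℝ ∞ (fun z => f (e.symm z)) e.target := by
  rw [← contMDiffOn_iff_contDiffOn]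
  exact f.contMDiff.comp_contMDiffOn (contMDiffOn_symm_of_mem_maximalAtlas he)

theorem sum_vecComp_smul_frame (he : e ∈ charts n M) (hy : y ∈ e.target)
    (ξ : Π x : M, TangentSpace (𝓡 n) x) :
    ∑ i, vecComp e ξ i y • frame e i y = ξ (e.symm y) := by
  rw [sum_smul_frame]
  have h := (mdifferentiable_of_mem_charts he).symm_comp_deriv (e.map_target hy)
  rw [e.right_inv hy] at h
  exact congrArg (fun L : TangentSpace (𝓡 n) (e.symm y) →L[ℝ] TangentSpace (𝓡 n) (e.symm y) =>
    L (ξ (e.symm y))) h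

theorem eq_zero_of_sum_smul_frame_eq_zero (he : e ∈ charts n M) (hy : y ∈ e.target)
    {c : Fin n → ℝ} (h : ∑ i, c i • frame e i y = 0) : c = 0 := by
  rw [sum_smul_frame] at h
  have hcomp := congrArg (fun L : Coord n →L[ℝ] Coord n => L (WithLp.toLp 2 c))
    ((mdifferentiable_of_mem_charts he).comp_symm_deriv hy)
  have hc : (WithLp.toLp 2 c : Coord n) = 0 := by
    refine hcomp.symm.trans ?_
    change mfderiv (𝓡 n) (𝓡 n) e (e.symm y) (mfderiv (𝓡 n) (𝓡 n) e.symm y _) = _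
    rw [h]
    exact map_zero _
  exact congrArg WithLp.ofLp hc

theorem isUnit_det_tensorComp_metric (he : e ∈ charts n M) (g : Metric n M) (hy : y ∈ e.target) :
    IsUnit (Matrix.of fun i j => tensorComp e g.inner i j y).det := by
  rw [isUnit_iff_ne_zero]
  intro hdet
  obtain ⟨c, hc, hcG⟩ := Matrix.exists_vecMul_eq_zero_iff.2 hdet
  set v := ∑ i, c i • frame e i y with hv
  have orthogonal (j : Fin n) : g.inner (e.symm y) v (frame e j y) = 0 := by
    rw [hv, inner_sum_smul_frame]
    exact congrFun hcG j
  have hvv : g.inner (e.symm y) v v = 0 := by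
    conv_lhs => rw [hv]
    rw [map_sum]
    exact Finset.sum_eq_zero fun j _ => by rw [map_smul, orthogonal, smul_zero]
  by_cases hv0 : v = 0
  · exact hc (eq_zero_of_sum_smul_frame_eq_zero he hy hv0)
  · exact (g.pos (e.symm y) v hv0).ne' hvv

theorem isMetricOn_tensorComp (he : e ∈ charts n M) (g : Metric n M) :
    IsMetricOn e.target (tensorComp e g.inner) where
  isOpen := e.open_target
  smooth := contDiffOn_tensorComp he g.contMDiff
  symm _ _ _ _ := g.symm _ _ _
  isUnit_det _ hz := isUnit_det_tensorComp_metric he g hz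

theorem vecComp_eq_sharp (he : e ∈ charts n M) (hy : y ∈ e.target) {g : Metric n M}
    {ξ : VectorField n M} {θ : OneForm n M}
    (hθ : ∀ (x : M) (v : TangentSpace (𝓡 n) x), θ x v = g.inner x (ξ x) v) (i : Fin n) :
    vecComp e ξ i y = sharp (tensorComp e g.inner) (formComp e θ) i y := by
  have hG := isMetricOn_tensorComp he g
  have lower : (fun j => formComp e θ j y) =
      (compMat (tensorComp e g.inner) y).mulVec fun k => vecComp e ξ k y := by
    funext j
    calc formComp e θ j y
        = g.inner (e.symm y) (∑ k, vecComp e ξ k y • frame e k y) (frame e j y) := by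
          rw [sum_vecComp_smul_frame he hy, formComp, hθ]
      _ = ∑ k, vecComp e ξ k y * tensorComp e g.inner k j y := inner_sum_smul_frame _ _ _
      _ = ∑ k, tensorComp e g.inner j k y * vecComp e ξ k y :=
          Finset.sum_congr rfl fun k _ => by rw [hG.symm y hy j k, mul_comm]
  have raise : (invMat (tensorComp e g.inner) y).mulVec (fun j => formComp e θ j y) =
      fun k => vecComp e ξ k y := by
    rw [lower, Matrix.mulVec_mulVec, hG.invMat_mul_compMat hy, Matrix.one_mulVec]
  exact (congrFun raise i).symm

theorem isInfinitesimalHarmonic_iff_sampson_eq_zero {g : Metric n M} {ξ : VectorField n M}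
    {θ : OneForm n M}
    (hθ : ∀ (x : M) (v : TangentSpace (𝓡 n) x), θ x v = g.inner x (ξ x) v) :
    IsInfinitesimalHarmonic g ξ ↔ ∀ e ∈ charts n M, ∀ y ∈ e.target, ∀ i,
      sampson (tensorComp e g.inner) (formComp e θ) i y = 0 := by
  refine forall₄_congr fun e he y hy => ?_
  have hG := isMetricOn_tensorComp he g
  have hform := contDiffOn_formComp he θ
  have hξ : ∀ᶠ z in 𝓝 y, ∀ k,
      vecComp e ξ k z = sharp (tensorComp e g.inner) (formComp e θ) k z :=
    (hG.eventually_mem hy).mono fun z hz => vecComp_eq_sharp he hz hθ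
  have hfamily (Φ : ℝ → Coord n → Coord n) : IsLocalFamily (vecComp e ξ) Φ y ↔
      IsLocalFamily (sharp (tensorComp e g.inner) (formComp e θ)) Φ y :=
    ⟨fun h => h.congr hξ, fun h => h.congr (hξ.mono fun _ hz k => (hz k).symm)⟩
  simp only [hfamily]
  rw [hG.forall_hasDerivAt_tension_zero_iff hy (hG.contDiffOn_sharp hform),
    hG.forall_sampson_eq_zero_iff hy hform]

theorem isLocallyConstant_of_pd_comp_chart_symm_eq_zero {f : C^∞⟮𝓡 n, M; ℝ⟯}
    (h : ∀ e ∈ charts n M, ∀ y ∈ e.target, ∀ i, pd i (fun z => f (e.symm z)) y = 0) :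
    IsLocallyConstant f := by
  rw [IsLocallyConstant.iff_eventually_eq]
  intro x
  set e := chartAt (Coord n) x
  have he : e ∈ charts n M := IsManifold.chart_mem_maximalAtlas x
  have hx : x ∈ e.source := mem_chart_source _ x
  obtain ⟨r, hr, hball⟩ := Metric.isOpen_iff.1 e.open_target (e x) (e.map_source hx)
  have const_on_ball : ∀ z ∈ Metric.ball (e x) r, f (e.symm z) = f (e.symm (e x)) := by
    intro z hz
    refine (convex_ball (e x) r).is_const_of_fderivWithin_eq_zero (𝕜 := ℝ)
      (f := fun z => f (e.symm z))
      (((contDiffOn_comp_chart_symm he f).mono hball).differentiableOn (by simp))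
      (fun w hw => ?_) hz (Metric.mem_ball_self hr)
    rw [fderivWithin_of_isOpen Metric.isOpen_ball hw]
    ext v
    rw [fderiv_eq_sum_pd]
    exact Finset.sum_eq_zero fun i _ => by rw [h e he w (hball hw) i, mul_zero]
  filter_upwards [(e.isOpen_inter_preimage Metric.isOpen_ball).mem_nhds
    ⟨hx, Metric.mem_ball_self hr⟩] with w hw
  simpa only [e.left_inv hw.1, e.left_inv hx] using const_on_ball (e w) hw.2

theorem exists_eq_const_iff_pd_eq_zero [PreconnectedSpace M] (f : C^∞⟮𝓡 n, M; ℝ⟯) :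
    (∃ c : ℝ, ∀ x, f x = c) ↔
      ∀ e ∈ charts n M, ∀ y ∈ e.target, ∀ i, pd i (fun z => f (e.symm z)) y = 0 := by
  constructor
  · rintro ⟨c, hc⟩ e - y - i
    simp only [hc, pd_eq_pderiv, pderiv_const]
  · intro h
    have hloc := isLocallyConstant_of_pd_comp_chart_symm_eq_zero h
    cases isEmpty_or_nonempty M with
    | inl _ => exact ⟨0, isEmptyElim⟩
    | inr hM => exact ⟨f hM.some, fun x => hloc.apply_eq_of_preconnectedSpace x hM.some⟩

theorem IsYorkDecompositionRic.sampson_eq {g : Metric n M} {θ : OneForm n M}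
    {lam : C^∞⟮𝓡 n, M; ℝ⟯} {φ : TwoTensor n M} (h : IsYorkDecompositionRic g θ lam φ)
    (he : e ∈ charts n M) (hy : y ∈ e.target) (i : Fin n) :
    sampson (tensorComp e g.inner) (formComp e θ) i y
      = -((n : ℝ) - 2) * pd i (fun z => lam (e.symm z)) y :=
  (isMetricOn_tensorComp he g).sampson_eq_of_ricci_eq (contDiffOn_formComp he θ)
    (contDiffOn_comp_chart_symm he lam) (contDiffOn_tensorComp he φ.contMDiff)
    (h.isTT.divergence_eq_zero e he) (h.isTT.trace_eq_zero e he) (h.ricci_eq e he) hy i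

end Components

end YorkRicci

end

open YorkRicci in
theorem proposition2_general {n : ℕ} (hn : n ≠ 2) {M : Type*} [TopologicalSpace M]
    [ChartedSpace (Coord n) M] [IsManifold (𝓡 n) ∞ M]
    (g : YorkRicci.Metric n M) (ξ : VectorField n M) (θ : OneForm n M)
    (hθ : ∀ (x : M) (v : TangentSpace (𝓡 n) x), θ x v = g.inner x (ξ x) v)
    (lam : C^∞⟮𝓡 n, M; ℝ⟯) (φ : TwoTensor n M) (h : IsYorkDecompositionRic g θ lam φ) :
    (∀ e ∈ charts n M, ∀ y ∈ e.target, ∀ i,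
      sampson (tensorComp e g.inner) (formComp e θ) i y
        = -((n : ℝ) - 2) * pd i (fun z => lam (e.symm z)) y) ∧
    (PreconnectedSpace M →
      ((∃ c : ℝ, ∀ x, lam x = c) ↔ IsInfinitesimalHarmonic g ξ)) := by
  refine ⟨fun e he y hy => h.sampson_eq he hy, fun _ => ?_⟩
  have hn' : -((n : ℝ) - 2) ≠ 0 := neg_ne_zero.2 (sub_ne_zero.2 (by exact_mod_cast hn))
  rw [exists_eq_const_iff_pd_eq_zero, isInfinitesimalHarmonic_iff_sampson_eq_zero hθ]
  refine forall₄_congr fun e he y hy => forall_congr' fun i => ?_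
  rw [h.sampson_eq he hy, mul_eq_zero, or_iff_right hn']

open YorkRicci in
theorem proposition2 {n : ℕ} (hn : 3 ≤ n) {M : Type*} [TopologicalSpace M] [T2Space M]
    [CompactSpace M] [ChartedSpace (Coord n) M] [IsManifold (𝓡 n) ∞ M]
    (g : YorkRicci.Metric n M) (ξ : VectorField n M) (θ : OneForm n M)
    (hθ : ∀ (x : M) (v : TangentSpace (𝓡 n) x), θ x v = g.inner x (ξ x) v)
    (lam : C^∞⟮𝓡 n, M; ℝ⟯) (φ : TwoTensor n M) (h : IsYorkDecompositionRic g θ lam φ) :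
    (∀ e ∈ charts n M, ∀ y ∈ e.target, ∀ i,
      sampson (tensorComp e g.inner) (formComp e θ) i y
        = -((n : ℝ) - 2) * pd i (fun z => lam (e.symm z)) y) ∧
    (PreconnectedSpace M →
      ((∃ c : ℝ, ∀ x, lam x = c) ↔ IsInfinitesimalHarmonic g ξ)) :=
  proposition2_general (by omega) g ξ θ hθ lam φ h
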